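/- Let $\mathfrak g$ be the split real Kac–Moody algebra of type $E_{10}$: the real Lie algebra with generators $e_i,f_i,h_i$ ($1\le i\le 10$) and the Chevalley–Serre relations for the Cartan matrix $A$ of the $E_{10}$ Dynkin diagram, in which the nodes $1,\dots,9$ form a line and node $10$ is joined to node $7$. Let $\omega$ be the Cartan–Chevalley involution, $\omega(e_i)=-f_i$, $\omega(f_i)=-e_i$, $\omega(h_i)=-h_i$, let $K(E_{10})=\{x\in\mathfrak g : \omega(x)=x\}$, and put $x_i=e_i-f_i\in K(E_{10})$. Let $G^{ab}=\delta^{ab}-\tfrac19$ ($1\le a,b\le 10$), and let the simple roots $\alpha_i$ have components $\alpha_i=e^i-e^{i+1}$ for $1\le i\le 9$ and $\alpha_{10}=e^8+e^9+e^{10}$, where $e^a$ denotes the $a$-th unit vector; indices are raised by $\alpha^a=\sum_b G^{ab}\alpha_b$. Real $32\times 32$ matrices $\Gamma_1,\dots,\Gamma_{10}$ with $\Gamma_a\Gamma_b+\Gamma_b\Gamma_a=2\delta_{ab}$ exist. For any such matrices put $\Gamma(\alpha_i)=\Gamma_i\Gamma_{i+1}$ for $1\le i\le 9$ and $\Gamma(\alpha_{10})=\Gamma_8\Gamma_9\Gamma_{10}$.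 Then there is a unique representation $\rho_{1/2}$ of $K(E_{10})$ on $\mathbb R^{32}$ (the spin-$\tfrac12$ representation) with $$\rho_{1/2}(x_i)=\tfrac12\,\Gamma(\alpha_i)\qquad(1\le i\le 10),$$ and a unique representation $\rho_{3/2}$ of $K(E_{10})$ on $\mathbb R^{10}\otimes\mathbb R^{32}$ (the spin-$\tfrac32$ representation) with $$\rho_{3/2}(x_i)=-2\,X(\alpha_i)\otimes\Gamma(\alpha_i),\qquad X(\alpha)^a{}_b=-\tfrac12\,\alpha^a\alpha_b+\tfrac14\,\delta^a_b\qquad(1\le i\le 10).$$ The ideals $\mathfrak i_{1/2}=\ker\rho_{1/2}$ and $\mathfrak i_{3/2}=\ker\rho_{3/2}$ of $K(E_{10})$ are not nested: $\mathfrak i_{3/2}\not\subset\mathfrak i_{1/2}$ and $\mathfrak i_{1/2}\not\subset\mathfrak i_{3/2}$. -/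

import Mathlib

/-! ### Split real Kac-Moody algebras and their maximal compact subalgebras -/

namespace KacMoody

noncomputable section

open CartanMatrix

variable {B : Type} [DecidableEq B] (A : Matrix B B ℤ)

/-- The split real Kac-Moody algebra of a (nonsingular) generalised Cartan matrix `A`, i.e. the real
Lie algebra given by the Chevalley-Serre presentation. -/
abbrev Algebra : Type := Matrix.ToLieAlgebra ℝ A

/-- The quotient map from the free Lie algebra on the Chevalley generators. -/
def proj : FreeLieAlgebra ℝ (Generators B) →ₗ⁅ℝ⁆ Algebra A :=
  { (Submodule.mkQ (Relations.toIdeal ℝ A).toSubmodule :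
      FreeLieAlgebra ℝ (Generators B) →ₗ[ℝ] _) with
    map_lie' := fun {_ _} => rfl }

/-- The Chevalley generators `e_i`. -/
def e (i : B) : Algebra A := proj A (FreeLieAlgebra.of ℝ (Generators.E i))

/-- The Chevalley generators `f_i`. -/
def f (i : B) : Algebra A := proj A (FreeLieAlgebra.of ℝ (Generators.F i))

/-- The Chevalley generators `h_i`. -/
def h (i : B) : Algebra A := proj A (FreeLieAlgebra.of ℝ (Generators.H i))

theorem proj_eq_zero {x : FreeLieAlgebra ℝ (Generators B)}
    (hx : x ∈ Relations.toSet ℝ A) : proj A x = 0 :=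
  (Submodule.Quotient.mk_eq_zero _).2 (LieSubmodule.subset_lieSpan hx)

theorem h_lie_h (i j : B) : ⁅h A i, h A j⁆ = 0 := by
  have := proj_eq_zero A (x := Relations.HH ℝ (i, j)) (by simp [Relations.toSet])
  simpa [Relations.HH, h] using this

theorem e_lie_f (i j : B) : ⁅e A i, f A j⁆ = if i = j then h A i else 0 := by
  have := proj_eq_zero A (x := Relations.EF ℝ (i, j)) (by simp [Relations.toSet])
  by_cases hij : i = j
  · subst hij
    simpa [Relations.EF, h, e, f, sub_eq_zero] using this
  · simpa [Relations.EF, h, e, f, hij] using this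

theorem h_lie_e (i j : B) : ⁅h A i, e A j⁆ = A i j • e A j := by
  have := proj_eq_zero A (x := Relations.HE ℝ A (i, j)) (by simp [Relations.toSet])
  simpa [Relations.HE, h, e, sub_eq_zero] using this

theorem h_lie_f (i j : B) : ⁅h A i, f A j⁆ = -(A i j • f A j) := by
  have := proj_eq_zero A (x := Relations.HF ℝ A (i, j)) (by simp [Relations.toSet])
  simpa [Relations.HF, h, f, add_eq_zero_iff_eq_neg] using this

theorem map_ad_pow {L L' : Type} [LieRing L] [LieAlgebra ℝ L] [LieRing L'] [LieAlgebra ℝ L']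
    (φ : L →ₗ⁅ℝ⁆ L') (x y : L) (n : ℕ) :
    φ ((LieAlgebra.ad ℝ L x ^ n) y) = (LieAlgebra.ad ℝ L' (φ x) ^ n) (φ y) := by
  induction n with
  | zero => simp
  | succ n ih => simp [pow_succ', ih]

theorem serre_e (i j : B) :
    (LieAlgebra.ad ℝ (Algebra A) (e A i) ^ (-A i j).toNat) ⁅e A i, e A j⁆ = 0 := by
  have := proj_eq_zero A (x := Relations.adE ℝ A (i, j)) (by simp [Relations.toSet])
  simpa [Relations.adE, e, map_ad_pow] using this

theorem serre_f (i j : B) :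
    (LieAlgebra.ad ℝ (Algebra A) (f A i) ^ (-A i j).toNat) ⁅f A i, f A j⁆ = 0 := by
  have := proj_eq_zero A (x := Relations.adF ℝ A (i, j)) (by simp [Relations.toSet])
  simpa [Relations.adF, f, map_ad_pow] using this

theorem ad_neg_pow_eq_zero {L : Type} [LieRing L] [LieAlgebra ℝ L] (x y : L) (n : ℕ)
    (hxy : (LieAlgebra.ad ℝ L x ^ n) y = 0) : (LieAlgebra.ad ℝ L (-x) ^ n) y = 0 := by
  rw [map_neg, neg_pow]
  rcases neg_one_pow_eq_or (Module.End ℝ L) n with hn | hn <;> simp [hn, hxy]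

/-- The values of the Cartan-Chevalley involution on the generators:
`e_i ↦ -f_i`, `f_i ↦ -e_i`, `h_i ↦ -h_i`. -/
def involutionGen : Generators B → Algebra A
  | Generators.H i => -h A i
  | Generators.E i => -f A i
  | Generators.F i => -e A i

/-- The extension of `involutionGen` to the free Lie algebra. -/
def involutionFree : FreeLieAlgebra ℝ (Generators B) →ₗ⁅ℝ⁆ Algebra A :=
  FreeLieAlgebra.lift ℝ (involutionGen A)

theorem toIdeal_le_ker : Relations.toIdeal ℝ A ≤ (involutionFree A).ker := by
  refine LieSubmodule.lieSpan_le.2 ?_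
  rintro x (((((⟨⟨i, j⟩, rfl⟩ | ⟨⟨i, j⟩, rfl⟩) | ⟨⟨i, j⟩, rfl⟩) | ⟨⟨i, j⟩, rfl⟩) | ⟨⟨i, j⟩, rfl⟩) |
    ⟨⟨i, j⟩, rfl⟩) <;> simp only [SetLike.mem_coe, LieHom.mem_ker]
  · simp [Relations.HH, involutionFree, involutionGen, h_lie_h]
  · by_cases hij : i = j
    · subst hij
      simp [Relations.EF, involutionFree, involutionGen]
      rw [← lie_skew, e_lie_f]
      simp
    · simp [Relations.EF, involutionFree, involutionGen, hij]
      rw [← lie_skew, e_lie_f]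
      simp [Ne.symm hij]
  · simp [Relations.HE, involutionFree, involutionGen, h_lie_f]
  · simp [Relations.HF, involutionFree, involutionGen, h_lie_e]
  · simp only [Relations.adE, Function.uncurry_apply_pair, map_ad_pow]
    simpa [involutionFree, involutionGen] using ad_neg_pow_eq_zero _ _ _ (serre_f A i j)
  · simp only [Relations.adF, Function.uncurry_apply_pair, map_ad_pow]
    simpa [involutionFree, involutionGen] using ad_neg_pow_eq_zero _ _ _ (serre_e A i j)

/-- The Cartan-Chevalley involution `ω`, the endomorphism of the Lie algebra with
`ω(e_i) = -f_i`, `ω(f_i) = -e_i`, `ω(h_i) = -h_i`. -/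
def involution : Algebra A →ₗ⁅ℝ⁆ Algebra A :=
  { (Submodule.liftQ (Relations.toIdeal ℝ A).toSubmodule (involutionFree A).toLinearMap
      (fun _ hx => (LieHom.mem_ker).1 (toIdeal_le_ker A hx)) : _ →ₗ[ℝ] Algebra A) with
    map_lie' := by
      intro x y
      induction x using Submodule.Quotient.induction_on
      induction y using Submodule.Quotient.induction_on
      exact (involutionFree A).map_lie _ _ }

theorem involution_proj (x : FreeLieAlgebra ℝ (Generators B)) :
    involution A (proj A x) = involutionFree A x := rfl

theorem involution_e (i : B) : involution A (e A i) = -f A i := by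
  simp [e, involution_proj, involutionFree, involutionGen]

theorem involution_f (i : B) : involution A (f A i) = -e A i := by
  simp [f, involution_proj, involutionFree, involutionGen]

theorem involution_h (i : B) : involution A (h A i) = -h A i := by
  simp [h, involution_proj, involutionFree, involutionGen]

/-- The maximal compact subalgebra `K(𝔤)`, i.e. the fixed points of the Cartan-Chevalley
involution. -/
def maximalCompact : LieSubalgebra ℝ (Algebra A) where
  carrier := {x | involution A x = x}
  add_mem' := fun {u v} (hu : involution A u = u) (hv : involution A v = v) =>
    show involution A (u + v) = u + v by rw [map_add, hu, hv]
  zero_mem' := map_zero _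
  smul_mem' := fun c u (hu : involution A u = u) =>
    show involution A (c • u) = c • u by rw [map_smul, hu]
  lie_mem' := fun {u v} (hu : involution A u = u) (hv : involution A v = v) =>
    show involution A ⁅u, v⁆ = ⁅u, v⁆ by rw [LieHom.map_lie, hu, hv]

/-- The element `x_i = e_i - f_i` of `K(𝔤)`. -/
def x (i : B) : maximalCompact A :=
  ⟨e A i - f A i, by
    change involution A (e A i - f A i) = e A i - f A i
    rw [map_sub, involution_e, involution_f]
    abel⟩

end

end KacMoody

-- Matrix algebras are Lie algebras under the commutator.
attribute [local instance 100] LieRing.ofAssociativeRing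

/-! ### The spin-1/2 and spin-3/2 representations of `K(E₁₀)` -/

namespace E10

noncomputable section

open scoped Kronecker

/-- The Cartan matrix of `E₁₀`: the nodes `0, …, 8` form a line and the node `9` is joined to the
node `6`. -/
def cartan : Matrix (Fin 10) (Fin 10) ℤ :=
  !![ 2, -1,  0,  0,  0,  0,  0,  0,  0,  0;
     -1,  2, -1,  0,  0,  0,  0,  0,  0,  0;
      0, -1,  2, -1,  0,  0,  0,  0,  0,  0;
      0,  0, -1,  2, -1,  0,  0,  0,  0,  0;
      0,  0,  0, -1,  2, -1,  0,  0,  0,  0;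
      0,  0,  0,  0, -1,  2, -1,  0,  0,  0;
      0,  0,  0,  0,  0, -1,  2, -1,  0, -1;
      0,  0,  0,  0,  0,  0, -1,  2, -1,  0;
      0,  0,  0,  0,  0,  0,  0, -1,  2,  0;
      0,  0,  0,  0,  0,  0, -1,  0,  0,  2]

/-- The Lie algebra `K(E₁₀)`. -/
abbrev K : LieSubalgebra ℝ (KacMoody.Algebra cartan) := KacMoody.maximalCompact cartan

/-- The components `α_a` of the simple root `α_i` in the wall basis:
`α_i = e^i - e^{i+1}` for the nine nodes on the line, and `e^7 + e^8 + e^9` for the last node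
(indices starting at `0`). -/
def simpleRoot (i : Fin 10) : Fin 10 → ℝ :=
  if i = 9 then Pi.single 7 1 + Pi.single 8 1 + Pi.single 9 1
  else Pi.single i 1 - Pi.single (i + 1) 1

/-- The DeWitt metric `G^{ab} = δ^{ab} - 1/9`. -/
def deWitt : Matrix (Fin 10) (Fin 10) ℝ :=
  Matrix.of fun a b => (if a = b then 1 else 0) - 1 / 9

/-- Real `32 × 32` gamma matrices: `Γ_a Γ_b + Γ_b Γ_a = 2 δ_{ab}`. -/
def IsGammaSystem (Γ : Fin 10 → Matrix (Fin 32) (Fin 32) ℝ) : Prop :=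
  ∀ a b, Γ a * Γ b + Γ b * Γ a = if a = b then 2 else 0

/-- The matrices `Γ(α_i)` of the simple roots: `Γ_{i} Γ_{i+1}` for the nine nodes on the line, and
`Γ_7 Γ_8 Γ_9` for the last node (indices starting at `0`). -/
def gammaRoot (Γ : Fin 10 → Matrix (Fin 32) (Fin 32) ℝ) (i : Fin 10) :
    Matrix (Fin 32) (Fin 32) ℝ :=
  if i = 9 then Γ 7 * Γ 8 * Γ 9 else Γ i * Γ (i + 1)

/-- The polarisation tensor `X(α)^a_b = -1/2 α^a α_b + 1/4 δ^a_b` of a simple root, with the index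
raised by the DeWitt metric. -/
def polarisation (i : Fin 10) : Matrix (Fin 10) (Fin 10) ℝ :=
  -(1 / 2 : ℝ) • Matrix.vecMulVec (deWitt.mulVec (simpleRoot i)) (simpleRoot i)
    + (1 / 4 : ℝ) • (1 : Matrix (Fin 10) (Fin 10) ℝ)

/-- `ρ` is the spin-1/2 representation: `x_i` acts on `ℝ³²` by `J(α_i) = 1/2 Γ(α_i)`. -/
def IsSpinHalf (Γ : Fin 10 → Matrix (Fin 32) (Fin 32) ℝ)
    (ρ : K →ₗ⁅ℝ⁆ Matrix (Fin 32) (Fin 32) ℝ) : Prop :=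
  ∀ i, ρ (KacMoody.x cartan i) = (1 / 2 : ℝ) • gammaRoot Γ i

/-- `ρ` is the spin-3/2 representation: `x_i` acts on `ℝ¹⁰ ⊗ ℝ³²` by
`J(α_i) = -2 X(α_i) ⊗ Γ(α_i)`. -/
def IsSpinThreeHalves (Γ : Fin 10 → Matrix (Fin 32) (Fin 32) ℝ)
    (ρ : K →ₗ⁅ℝ⁆ Matrix (Fin 10 × Fin 32) (Fin 10 × Fin 32) ℝ) : Prop :=
  ∀ i, ρ (KacMoody.x cartan i) =
    (-2 : ℝ) • (polarisation i ⊗ₖ gammaRoot Γ i)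

end

end E10

namespace KacMoody

noncomputable section

variable {B : Type} [DecidableEq B] (A : Matrix B B ℤ)

/-! ### Generation of the algebra and of its maximal compact subalgebra -/

/-! Indices start at 0, so the hyperbolic node is `0`, the affine node is `1`, and nodes `2` to `9`
span E₈; δ denotes the null root.

Uniqueness holds because the x_i generate K(𝔤). The algebra is the sum of the brackets of the e_i,
their ω-images and the span of the h_i, and a fixed point y equals ½(y + ωy). The symmetrisation of
[e_k, v] is [x_k, v + ωv] plus the symmetrisation of [f_k, v], which is shorter
(`maximalCompact_le_xSpan`).

Existence is Berman's presentation for targets in an associative algebra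
(`exists_maximalCompact_hom`): it suffices that [X_i, X_j] = 0 or [X_i, [X_i, X_j]] = -X_j according
to the Cartan entry. On the Verma module of highest weight zero a linear map is built that sends the
vacuum to 1 and turns e_j - f_j into left multiplication by X_j. The relations make it vanish on the
Serre submodule, and y is represented by the value at y applied to the vacuum. The relations hold
here because the Γ(α_i) square to -1 and commute up to (-1)^{A_ij}, while -2X(α) = P(α) = α⊗α - ½
has simple anticommutators.

For the kernels, brackets along chains of simple roots give, for suitable real roots γ, an element y
of K with images ½Γ(γ) and ±P(γ)⊗Γ(γ). If (γ|α_0) is odd, then [y,[y,x_0]] + x_0 vanishes in spin ½,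
but in spin 3/2 it equals -2((γ|α_0)² - 1) γ⊗γ ⊗ Γ(α_0). For γ = 2δ + α_1 the pairing is -3, so the
spin-½ kernel is not contained in the other one.

Conversely, let `kernelImage` be the space of M such that M⊗Γ(α_0) comes from the spin-½ kernel.
Double brackets with the elements y preserve it, acting through reflections of both tensor factors
when (γ|α_0) is even and through M ↦ (γ⊗γ) M (γ⊗γ) when it is odd. These operations spread the dyad
of 2δ + α_1 to all symmetric dyads (`IsRootInvariant.eq_zero`), hence to P(α_0). So some w in the
spin-½ kernel has the same spin-3/2 image as x_0, and x_0 - w is killed in spin 3/2 but acts by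
½Γ(α_0) ≠ 0 in spin ½. -/

theorem proj_surjective : Function.Surjective (proj A) :=
  Submodule.mkQ_surjective (CartanMatrix.Relations.toIdeal ℝ A).toSubmodule

/-- A Lie subalgebra containing the Chevalley generators is everything. -/
theorem mem_of_generators (S : LieSubalgebra ℝ (Algebra A)) (he : ∀ i, e A i ∈ S)
    (hf : ∀ i, f A i ∈ S) (hh : ∀ i, h A i ∈ S) (y : Algebra A) : y ∈ S := by
  obtain ⟨z, rfl⟩ := proj_surjective A y
  let φ : FreeLieAlgebra ℝ (CartanMatrix.Generators B) →ₗ⁅ℝ⁆ S := FreeLieAlgebra.lift ℝ fun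
    | .H i => ⟨h A i, hh i⟩
    | .E i => ⟨e A i, he i⟩
    | .F i => ⟨f A i, hf i⟩
  have key : proj A = S.incl.comp φ := by
    apply FreeLieAlgebra.hom_ext
    rintro (i | i | i) <;> simp [φ, e, f, h]
  rw [key]
  exact (φ z).2

theorem involution_involution (y : Algebra A) : involution A (involution A y) = y := by
  have := mem_of_generators A
    { carrier := {y | involution A (involution A y) = y}
      add_mem' := fun {u v} hu hv => by simp_all
      zero_mem' := by simp
      smul_mem' := fun c u hu => by simp_all
      lie_mem' := fun {u v} hu hv => by simp_all }
    (fun i => by change involution A (involution A (e A i)) = e A i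
                 simp [involution_e, involution_f])
    (fun i => by change involution A (involution A (f A i)) = f A i
                 simp [involution_e, involution_f])
    (fun i => by change involution A (involution A (h A i)) = h A i
                 simp [involution_h]) y
  exact this

/-- The span of the `h_i`. -/
def cartanSpan : Submodule ℝ (Algebra A) := Submodule.span ℝ (Set.range (h A))

/-- The span of the left-normed brackets of the `e_i` of length between `1` and `n`. -/
def posFiltration : ℕ → Submodule ℝ (Algebra A)
  | 0 => ⊥
  | n + 1 => Submodule.span ℝ (Set.range (e A)) ⊔
      ⨆ k, (posFiltration n).map (LieAlgebra.ad ℝ (Algebra A) (e A k) : _ →ₗ[ℝ] _)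

theorem posFiltration_mono : Monotone (posFiltration A) := by
  apply monotone_nat_of_le_succ
  intro n
  induction n with
  | zero => exact bot_le
  | succ n ih => exact sup_le_sup le_rfl (iSup_mono fun k => Submodule.map_mono ih)

theorem e_mem_posFiltration (i : B) (n : ℕ) : e A i ∈ posFiltration A (n + 1) :=
  Submodule.mem_sup_left (Submodule.subset_span ⟨i, rfl⟩)

theorem lie_e_mem_posFiltration {n : ℕ} (k : B) {v : Algebra A} (hv : v ∈ posFiltration A n) :
    ⁅e A k, v⁆ ∈ posFiltration A (n + 1) :=
  Submodule.mem_sup_right (Submodule.mem_iSup_of_mem k ⟨v, hv, rfl⟩)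

/-- To check an inclusion of `posFiltration (n + 1)` it suffices to look at brackets. -/
theorem posFiltration_succ_le {n : ℕ} {P : Submodule ℝ (Algebra A)} (he : ∀ i, e A i ∈ P)
    (hb : ∀ k, ∀ v ∈ posFiltration A n, ⁅e A k, v⁆ ∈ P) : posFiltration A (n + 1) ≤ P := by
  refine sup_le (Submodule.span_le.2 ?_) (iSup_le fun k => ?_)
  · rintro _ ⟨i, rfl⟩
    exact he i
  · rintro _ ⟨v, hv, rfl⟩
    exact hb k v hv

theorem lie_h_mem_posFiltration (n : ℕ) (i : B) :
    ∀ v ∈ posFiltration A n, ⁅h A i, v⁆ ∈ posFiltration A n := by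
  induction n with
  | zero => intro v hv; rw [(Submodule.mem_bot ℝ).1 hv]; simp
  | succ n ih =>
    refine posFiltration_succ_le A
      (P := (posFiltration A (n + 1)).comap (LieAlgebra.ad ℝ (Algebra A) (h A i) : _ →ₗ[ℝ] _))
      (fun j => ?_) (fun k v hv => ?_)
    · change ⁅h A i, e A j⁆ ∈ posFiltration A (n + 1)
      rw [h_lie_e]
      exact zsmul_mem (e_mem_posFiltration A j n) _
    · change ⁅h A i, ⁅e A k, v⁆⁆ ∈ posFiltration A (n + 1)
      rw [leibniz_lie, h_lie_e, zsmul_lie]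
      exact add_mem (zsmul_mem (lie_e_mem_posFiltration A k hv) _)
        (lie_e_mem_posFiltration A k (ih v hv))

theorem lie_cartanSpan_mem_posFiltration {n : ℕ} {c v : Algebra A} (hc : c ∈ cartanSpan A)
    (hv : v ∈ posFiltration A n) : ⁅c, v⁆ ∈ posFiltration A n := by
  induction hc using Submodule.span_induction with
  | mem x hx => obtain ⟨i, rfl⟩ := hx; exact lie_h_mem_posFiltration A n i v hv
  | zero => simp
  | add x y _ _ hx hy => rw [add_lie]; exact add_mem hx hy
  | smul a x _ hx => rw [smul_lie]; exact Submodule.smul_mem _ a hx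

theorem lie_e_cartanSpan {c : Algebra A} (hc : c ∈ cartanSpan A) (k : B) (n : ℕ) :
    ⁅e A k, c⁆ ∈ posFiltration A (n + 1) := by
  rw [← lie_skew]
  exact neg_mem (lie_cartanSpan_mem_posFiltration A hc (e_mem_posFiltration A k n))

/-- Moving f_i past e_k costs an h, which acts on the remaining shorter bracket; a single e_i drops
into the Cartan span. -/
theorem lie_f_mem (n : ℕ) (i : B) :
    ∀ v ∈ posFiltration A (n + 1), ⁅f A i, v⁆ ∈ posFiltration A n ⊔ cartanSpan A := by
  induction n with
  | zero =>
    refine posFiltration_succ_le A (n := 0) (P := (posFiltration A 0 ⊔ cartanSpan A).comap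
      (LieAlgebra.ad ℝ (Algebra A) (f A i) : _ →ₗ[ℝ] _)) (fun j => ?_) (fun k v hv => ?_)
    · change ⁅f A i, e A j⁆ ∈ posFiltration A 0 ⊔ cartanSpan A
      rw [← lie_skew, e_lie_f]
      refine neg_mem (Submodule.mem_sup_right ?_)
      split_ifs
      · exact Submodule.subset_span ⟨j, rfl⟩
      · exact zero_mem _
    · rw [(Submodule.mem_bot ℝ).1 hv]; simp
  | succ n ih =>
    refine posFiltration_succ_le A (n := n + 1) (P := (posFiltration A (n + 1) ⊔ cartanSpan A).comap
      (LieAlgebra.ad ℝ (Algebra A) (f A i) : _ →ₗ[ℝ] _)) (fun j => ?_) (fun k v hv => ?_)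
    · change ⁅f A i, e A j⁆ ∈ posFiltration A (n + 1) ⊔ cartanSpan A
      rw [← lie_skew, e_lie_f]
      refine neg_mem (Submodule.mem_sup_right ?_)
      split_ifs
      · exact Submodule.subset_span ⟨j, rfl⟩
      · exact zero_mem _
    · change ⁅f A i, ⁅e A k, v⁆⁆ ∈ posFiltration A (n + 1) ⊔ cartanSpan A
      rw [leibniz_lie, ← lie_skew (f A i), e_lie_f]
      refine Submodule.mem_sup_left (add_mem ?_ ?_)
      · rw [neg_lie]
        refine neg_mem ?_
        split_ifs
        · exact lie_h_mem_posFiltration A _ _ v hv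
        · simp
      · obtain ⟨p, hp, c, hc, hpc⟩ := Submodule.mem_sup.1 (ih v hv)
        rw [← hpc, lie_add]
        exact add_mem (lie_e_mem_posFiltration A k hp) (lie_e_cartanSpan A hc k n)

/-- The subalgebra generated by the `x_i`. -/
def xSpan : LieSubalgebra ℝ (Algebra A) :=
  LieSubalgebra.lieSpan ℝ _ (Set.range fun i => (x A i : Algebra A))

theorem x_mem_xSpan (i : B) : e A i - f A i ∈ xSpan A :=
  LieSubalgebra.subset_lieSpan ⟨i, rfl⟩

/-- The elements `y` whose symmetrisation `y + ω(y)` is generated by the `x_i`. -/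
def symmetrisable : Submodule ℝ (Algebra A) :=
  (xSpan A).toSubmodule.comap (LinearMap.id + (involution A : Algebra A →ₗ[ℝ] Algebra A))

theorem mem_symmetrisable {y : Algebra A} :
    y ∈ symmetrisable A ↔ y + involution A y ∈ xSpan A := Iff.rfl

theorem cartanSpan_le_symmetrisable : cartanSpan A ≤ symmetrisable A := by
  refine Submodule.span_le.2 ?_
  rintro _ ⟨i, rfl⟩
  simp [mem_symmetrisable, involution_h]

theorem posFiltration_le_symmetrisable (n : ℕ) : posFiltration A n ≤ symmetrisable A := by
  induction n with
  | zero => exact bot_le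
  | succ n ih =>
    refine posFiltration_succ_le A (fun i => ?_) (fun k v hv => ?_)
    · rw [mem_symmetrisable, involution_e, ← sub_eq_add_neg]
      exact x_mem_xSpan A i
    · have hfv : ⁅f A k, v⁆ ∈ symmetrisable A := by
        refine sup_le (a := posFiltration A n) ih (cartanSpan_le_symmetrisable A) ?_
        -- Regarding v as having length at most n + 1 puts [f_k, v] back at length n, where the
        -- induction hypothesis applies.
        exact lie_f_mem A n k v (posFiltration_mono A (Nat.le_succ n) hv)
      -- Since ω exchanges e_k and -f_k, [e_k, v] + ω[e_k, v] = [x_k, v + ωv] + ([f_k, v] + ω[f_k,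
      -- v]).
      have h1 := add_mem ((xSpan A).lie_mem (x_mem_xSpan A k) (ih hv)) hfv
      rw [mem_symmetrisable]
      convert h1 using 1
      simp only [LieHom.map_lie, involution_e, involution_f, LinearMap.add_apply, LinearMap.id_apply,
        LieHom.coe_toLinearMap, lie_add, sub_lie, neg_lie]
      abel

/-- The span of all brackets of the `e_i`. -/
def posSpan : Submodule ℝ (Algebra A) := ⨆ n, posFiltration A n

theorem mem_posSpan {v : Algebra A} : v ∈ posSpan A ↔ ∃ n, v ∈ posFiltration A n :=
  Submodule.mem_iSup_of_directed _ (posFiltration_mono A).directed_le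

/-- The sum of the spans of the brackets of the `e_i`, the brackets of the `f_i`, and the `h_i`. -/
def triangularSpan : Submodule ℝ (Algebra A) :=
  posSpan A ⊔ (posSpan A).map (involution A : Algebra A →ₗ[ℝ] Algebra A) ⊔ cartanSpan A

theorem posSpan_le_triangularSpan : posSpan A ≤ triangularSpan A :=
  le_sup_left.trans le_sup_left

theorem cartanSpan_le_triangularSpan : cartanSpan A ≤ triangularSpan A :=
  le_sup_right

theorem involution_mem_cartanSpan {c : Algebra A} (hc : c ∈ cartanSpan A) :
    involution A c ∈ cartanSpan A := by
  have : cartanSpan A ≤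
      (cartanSpan A).comap (involution A : Algebra A →ₗ[ℝ] Algebra A) := by
    refine Submodule.span_le.2 ?_
    rintro _ ⟨i, rfl⟩
    change involution A (h A i) ∈ cartanSpan A
    rw [involution_h]
    exact neg_mem (Submodule.subset_span ⟨i, rfl⟩)
  exact this hc

theorem involution_mem_triangularSpan {w : Algebra A} (hw : w ∈ triangularSpan A) :
    involution A w ∈ triangularSpan A := by
  have : triangularSpan A ≤
      (triangularSpan A).comap (involution A : Algebra A →ₗ[ℝ] Algebra A) := by
    refine sup_le (sup_le (fun v hv => ?_) ?_) (fun v hv => ?_)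
    · exact Submodule.mem_sup_left (Submodule.mem_sup_right ⟨v, hv, rfl⟩)
    · rintro _ ⟨v, hv, rfl⟩
      change involution A (involution A v) ∈ triangularSpan A
      rw [involution_involution]
      exact posSpan_le_triangularSpan A hv
    · exact cartanSpan_le_triangularSpan A (involution_mem_cartanSpan A hv)
  exact this hw

/-- On the negative half, [e_k, ωv] = -ω[f_k, v] reduces the claim to `lie_f_mem`. -/
theorem lie_e_mem_triangularSpan (k : B) {w : Algebra A} (hw : w ∈ triangularSpan A) :
    ⁅e A k, w⁆ ∈ triangularSpan A := by
  have : triangularSpan A ≤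
      (triangularSpan A).comap (LieAlgebra.ad ℝ (Algebra A) (e A k) : _ →ₗ[ℝ] _) := by
    refine sup_le (sup_le (fun v hv => ?_) ?_) (fun v hv => ?_)
    · obtain ⟨n, hn⟩ := (mem_posSpan A).1 hv
      exact posSpan_le_triangularSpan A ((mem_posSpan A).2 ⟨_, lie_e_mem_posFiltration A k hn⟩)
    · rintro _ ⟨v, hv, rfl⟩
      change ⁅e A k, involution A v⁆ ∈ triangularSpan A
      obtain ⟨n, hn⟩ := (mem_posSpan A).1 hv
      have h1 := lie_f_mem A n k v (posFiltration_mono A (Nat.le_succ n) hn)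
      have h2 : ⁅f A k, v⁆ ∈ triangularSpan A :=
        sup_le ((le_iSup (posFiltration A) n).trans (posSpan_le_triangularSpan A))
          (cartanSpan_le_triangularSpan A) h1
      have h3 := neg_mem (involution_mem_triangularSpan A h2)
      simpa [involution_f] using h3
    · exact posSpan_le_triangularSpan A ((mem_posSpan A).2 ⟨_, lie_e_cartanSpan A hv k 0⟩)
  exact this hw

theorem lie_f_mem_triangularSpan (k : B) {w : Algebra A} (hw : w ∈ triangularSpan A) :
    ⁅f A k, w⁆ ∈ triangularSpan A := by
  have h1 := neg_mem (involution_mem_triangularSpan A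
    (lie_e_mem_triangularSpan A k (involution_mem_triangularSpan A hw)))
  simpa [involution_e, involution_involution] using h1

theorem lie_mem_triangularSpan (y : Algebra A) {w : Algebra A} (hw : w ∈ triangularSpan A) :
    ⁅y, w⁆ ∈ triangularSpan A := by
  let S : LieSubalgebra ℝ (Algebra A) :=
    { carrier := {y | ∀ w ∈ triangularSpan A, ⁅y, w⁆ ∈ triangularSpan A}
      add_mem' := fun {u v} hu hv w hw => by
        rw [add_lie]
        exact add_mem (hu w hw) (hv w hw)
      zero_mem' := fun w _ => by
        rw [zero_lie]
        exact zero_mem _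
      smul_mem' := fun c u hu w hw => by
        rw [smul_lie]
        exact Submodule.smul_mem _ c (hu w hw)
      lie_mem' := fun {u v} hu hv w hw => by
        rw [lie_lie]
        exact sub_mem (hu _ (hv w hw)) (hv _ (hu w hw)) }
  have he : ∀ i, e A i ∈ S := fun i w hw => lie_e_mem_triangularSpan A i hw
  have hf : ∀ i, f A i ∈ S := fun i w hw => lie_f_mem_triangularSpan A i hw
  refine mem_of_generators A S he hf (fun i => ?_) y w hw
  have := S.lie_mem (he i) (hf i)
  rwa [e_lie_f, if_pos rfl] at this

theorem mem_triangularSpan (y : Algebra A) : y ∈ triangularSpan A := by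
  have he : ∀ i, e A i ∈ triangularSpan A := fun i =>
    posSpan_le_triangularSpan A ((mem_posSpan A).2 ⟨1, e_mem_posFiltration A i 0⟩)
  refine mem_of_generators A { triangularSpan A with
    lie_mem' := fun {u v} _ hv => lie_mem_triangularSpan A u hv } he (fun i => ?_) (fun i => ?_) y
  · have := neg_mem (involution_mem_triangularSpan A (he i))
    rw [involution_e, neg_neg] at this
    exact this
  · exact cartanSpan_le_triangularSpan A (Submodule.subset_span ⟨i, rfl⟩)

theorem symmetrisable_eq_top : symmetrisable A = ⊤ := by
  have hp : posSpan A ≤ symmetrisable A := iSup_le (posFiltration_le_symmetrisable A)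
  refine eq_top_iff.2 (fun y _ => ?_)
  refine sup_le (sup_le hp ?_) (cartanSpan_le_symmetrisable A) (mem_triangularSpan A y)
  rintro _ ⟨v, hv, rfl⟩
  have h1 := hp hv
  rw [mem_symmetrisable, add_comm] at h1
  rw [mem_symmetrisable]
  simpa [involution_involution] using h1

theorem maximalCompact_le_xSpan : maximalCompact A ≤ xSpan A := by
  intro y hy
  have h1 : y ∈ symmetrisable A := by
    rw [symmetrisable_eq_top]
    trivial
  rw [mem_symmetrisable, show involution A y = y from hy, ← two_smul ℝ] at h1
  simpa using (xSpan A).smul_mem (1 / 2 : ℝ) h1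

/-- Homomorphisms on the maximal compact subalgebra are determined by the images of the `x_i`. -/
theorem maximalCompact_hom_ext {L : Type} [LieRing L] [LieAlgebra ℝ L]
    {φ ψ : maximalCompact A →ₗ⁅ℝ⁆ L} (hφ : ∀ i, φ (x A i) = ψ (x A i)) : φ = ψ := by
  let S : LieSubalgebra ℝ (Algebra A) :=
    { carrier := {y | ∃ hy : y ∈ maximalCompact A, φ ⟨y, hy⟩ = ψ ⟨y, hy⟩}
      add_mem' := by
        rintro u v ⟨hu, hu'⟩ ⟨hv, hv'⟩
        exact ⟨add_mem hu hv, (map_add φ ⟨u, hu⟩ ⟨v, hv⟩).trans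
          ((congrArg₂ (· + ·) hu' hv').trans (map_add ψ ⟨u, hu⟩ ⟨v, hv⟩).symm)⟩
      zero_mem' := ⟨zero_mem _, by
        rw [show (⟨0, zero_mem _⟩ : maximalCompact A) = 0 from rfl, map_zero, map_zero]⟩
      smul_mem' := by
        rintro c u ⟨hu, hu'⟩
        exact ⟨(maximalCompact A).smul_mem c hu, (map_smul φ c ⟨u, hu⟩).trans
          ((congrArg (c • ·) hu').trans (map_smul ψ c ⟨u, hu⟩).symm)⟩
      lie_mem' := by
        rintro u v ⟨hu, hu'⟩ ⟨hv, hv'⟩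
        exact ⟨(maximalCompact A).lie_mem hu hv, (LieHom.map_lie φ ⟨u, hu⟩ ⟨v, hv⟩).trans
          ((congrArg₂ (⁅·, ·⁆) hu' hv').trans (LieHom.map_lie ψ ⟨u, hu⟩ ⟨v, hv⟩).symm)⟩ }
  have hS : xSpan A ≤ S := LieSubalgebra.lieSpan_le.2 (by
    rintro _ ⟨i, rfl⟩
    exact ⟨(x A i).2, hφ i⟩)
  ext ⟨y, hy⟩
  obtain ⟨_, h⟩ := hS (maximalCompact_le_xSpan A hy)
  exact h

end

end KacMoody

namespace KacMoody

noncomputable section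

set_option linter.unusedSectionVars false

variable {B : Type} [DecidableEq B] (A : Matrix B B ℤ)

/-! ### Chevalley systems -/

/-- Elements of a Lie algebra satisfying the Chevalley relations (but not necessarily the Serre
relations). -/
structure IsChevalley {L : Type} [LieRing L] [LieAlgebra ℝ L] (E F H : B → L) : Prop where
  hh : ∀ i j, ⁅H i, H j⁆ = 0
  ef : ∀ i j, ⁅E i, F j⁆ = if i = j then H i else 0
  he : ∀ i j, ⁅H i, E j⁆ = A i j • E j
  hf : ∀ i j, ⁅H i, F j⁆ = -(A i j • F j)

/-- The Serre element attached to two generators. -/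
def serre {L : Type} [LieRing L] [LieAlgebra ℝ L] (E : B → L) (i j : B) : L :=
  (LieAlgebra.ad ℝ L (E i) ^ (-A i j).toNat) ⁅E i, E j⁆

theorem map_serre {L L' : Type} [LieRing L] [LieAlgebra ℝ L] [LieRing L'] [LieAlgebra ℝ L']
    (φ : L →ₗ⁅ℝ⁆ L') (E : B → L) (i j : B) : φ (serre A E i j) = serre A (φ ∘ E) i j := by
  simp [serre, map_ad_pow]

namespace IsChevalley

variable {A} {L : Type} [LieRing L] [LieAlgebra ℝ L] {E F H : B → L}

/-- This symmetry transfers every statement about the raising generators to the lowering ones. -/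
theorem symm (c : IsChevalley A E F H) : IsChevalley A F E (-H) where
  hh i j := by simp [c.hh]
  ef i j := by
    rw [← lie_skew, c.ef]
    by_cases hij : i = j
    · subst hij; simp
    · simp [hij, Ne.symm hij]
  he i j := by simp [c.hf]
  hf i j := by simp [c.he]

theorem map {L' : Type} [LieRing L'] [LieAlgebra ℝ L'] (c : IsChevalley A E F H)
    (φ : L →ₗ⁅ℝ⁆ L') : IsChevalley A (φ ∘ E) (φ ∘ F) (φ ∘ H) where
  hh i j := by simp [← LieHom.map_lie, c.hh]
  ef i j := by
    simp only [Function.comp_apply, ← LieHom.map_lie, c.ef]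
    split_ifs <;> simp
  he i j := by simp [← LieHom.map_lie, c.he]
  hf i j := by simp [← LieHom.map_lie, c.hf]

/-- A Chevalley system satisfying the Serre relations is the image of the Chevalley generators. -/
theorem exists_hom (c : IsChevalley A E F H) (hE : ∀ i j, serre A E i j = 0)
    (hF : ∀ i j, serre A F i j = 0) :
    ∃ φ : Algebra A →ₗ⁅ℝ⁆ L, (∀ i, φ (e A i) = E i) ∧ ∀ i, φ (f A i) = F i := by
  let g : FreeLieAlgebra ℝ (CartanMatrix.Generators B) →ₗ⁅ℝ⁆ L := FreeLieAlgebra.lift ℝ fun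
    | .H i => H i
    | .E i => E i
    | .F i => F i
  have hg : CartanMatrix.Relations.toIdeal ℝ A ≤ g.ker := by
    refine LieSubmodule.lieSpan_le.2 ?_
    rintro x (((((⟨⟨i, j⟩, rfl⟩ | ⟨⟨i, j⟩, rfl⟩) | ⟨⟨i, j⟩, rfl⟩) | ⟨⟨i, j⟩, rfl⟩) | ⟨⟨i, j⟩, rfl⟩) |
      ⟨⟨i, j⟩, rfl⟩) <;> simp only [SetLike.mem_coe, LieHom.mem_ker]
    · simp [CartanMatrix.Relations.HH, g, c.hh]
    · by_cases hij : i = j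
      · subst hij
        simp [CartanMatrix.Relations.EF, g, c.ef]
      · simp [CartanMatrix.Relations.EF, g, c.ef, hij]
    · simp [CartanMatrix.Relations.HE, g, c.he]
    · simp [CartanMatrix.Relations.HF, g, c.hf]
    · simp only [CartanMatrix.Relations.adE, Function.uncurry_apply_pair, map_ad_pow]
      simpa [g, serre] using hE i j
    · simp only [CartanMatrix.Relations.adF, Function.uncurry_apply_pair, map_ad_pow]
      simpa [g, serre] using hF i j
  refine ⟨{ (Submodule.liftQ (CartanMatrix.Relations.toIdeal ℝ A).toSubmodule g.toLinearMap
      (fun _ hx => (LieHom.mem_ker).1 (hg hx)) : _ →ₗ[ℝ] L) with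
    map_lie' := by
      intro x y
      induction x using Submodule.Quotient.induction_on
      induction y using Submodule.Quotient.induction_on
      exact g.map_lie _ _ }, fun i => ?_, fun i => ?_⟩
  · change g (FreeLieAlgebra.of ℝ (.E i)) = E i
    simp [g]
  · change g (FreeLieAlgebra.of ℝ (.F i)) = F i
    simp [g]

end IsChevalley

/-- Simply laced generalised Cartan matrices. -/
structure IsSimplyLaced : Prop where
  diag : ∀ i, A i i = 2
  symm : ∀ i j, A i j = A j i
  off : ∀ i j, i ≠ j → A i j = 0 ∨ A i j = -1

namespace IsChevalley

variable {A} {L : Type} [LieRing L] [LieAlgebra ℝ L] {E F H : B → L}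

theorem lie_E_H (c : IsChevalley A E F H) (i j : B) : ⁅E i, H j⁆ = -(A j i • E i) := by
  rw [← lie_skew, c.he]

theorem lie_lie_E_F (c : IsChevalley A E F H) (hA : IsSimplyLaced A) (i j k : B) (hij : i ≠ j) :
    ⁅⁅E i, E j⁆, F k⁆ = (if i = k then A i j • E j else 0) - if j = k then A i j • E i else 0 := by
  rw [lie_lie, c.ef, c.ef]
  by_cases hik : i = k
  · subst hik
    simp [hij.symm, c.lie_E_H]
  · by_cases hjk : j = k
    · subst hjk
      simp [hik, c.lie_E_H, hA.symm j i]
    · simp [hik, hjk]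

/-- The Serre elements in the `e_i` commute with the `f_k`. -/
theorem lie_serre (c : IsChevalley A E F H) (hA : IsSimplyLaced A) (i j k : B) :
    ⁅serre A E i j, F k⁆ = 0 := by
  by_cases hij : i = j
  · subst hij
    simp [serre]
  rcases hA.off i j hij with h0 | h1
  · simp [serre, h0, c.lie_lie_E_F hA i j k hij]
  · simp only [serre, h1, neg_neg, Int.toNat_one, pow_one, LieAlgebra.ad_apply]
    rw [lie_lie (E i), c.lie_lie_E_F hA i j k hij, c.ef, h1]
    by_cases hik : i = k
    · subst hik
      -- The bracket has H_i-weight 2 - 1 = 1, which cancels the term coming from [[E_i, E_j], F_i]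
      -- = -E_j.
      have h2 : ⁅⁅E i, E j⁆, H i⁆ = -⁅E i, E j⁆ := by
        rw [lie_lie, c.lie_E_H, c.lie_E_H, hA.diag, h1]
        simp only [lie_neg, lie_zsmul, ← lie_skew (E i) (E j)]
        abel
      simp [Ne.symm hij, h2]
    · by_cases hjk : j = k
      · subst hjk
        simp [hik]
      · simp [hik, hjk]

/-- The Serre elements are weight vectors. -/
theorem lie_H_serre (c : IsChevalley A E F H) (i j k : B) :
    ∃ z : ℤ, ⁅H k, serre A E i j⁆ = z • serre A E i j := by
  unfold serre
  induction (-A i j).toNat with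
  | zero =>
    refine ⟨A k i + A k j, ?_⟩
    simp [leibniz_lie (H k), c.he, add_smul]
  | succ n ih =>
    obtain ⟨z, hz⟩ := ih
    refine ⟨A k i + z, ?_⟩
    rw [pow_succ', Module.End.mul_apply, LieAlgebra.ad_apply, leibniz_lie, c.he, hz, add_smul]
    simp

end IsChevalley

/-! ### The Verma module of highest weight zero of the algebra without Serre relations -/

/-- Words in the lowering operators. -/
abbrev Verma (B : Type) : Type := List B →₀ ℝ

/-- The lowering operators prefix a letter. -/
def lower (j : B) : Module.End ℝ (Verma B) := Finsupp.lmapDomain ℝ ℝ (List.cons j)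

/-- The Cartan operators are diagonal. -/
def cartanOp (i : B) : Module.End ℝ (Verma B) :=
  Finsupp.linearCombination ℝ fun w => -((w.map (A i)).sum : ℝ) • Finsupp.single w 1

/-- The action of the raising operators on words. -/
def raiseWord (i : B) : List B → Verma B
  | [] => 0
  | j :: w => lower j (raiseWord i w) + if i = j then cartanOp A i (Finsupp.single w 1) else 0

/-- The raising operators. -/
def raise (i : B) : Module.End ℝ (Verma B) := Finsupp.linearCombination ℝ (raiseWord A i)

@[simp] theorem lower_single (j : B) (w : List B) (c : ℝ) :
    lower j (Finsupp.single w c) = Finsupp.single (j :: w) c := by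
  simp [lower]

@[simp] theorem cartanOp_single (i : B) (w : List B) (c : ℝ) :
    cartanOp A i (Finsupp.single w c) = -((w.map (A i)).sum : ℝ) • Finsupp.single w c := by
  simp [cartanOp, mul_comm]

@[simp] theorem raise_nil (i : B) (c : ℝ) : raise A i (Finsupp.single [] c) = 0 := by
  simp [raise, raiseWord]

theorem raise_cons (i j : B) (w : List B) (c : ℝ) :
    raise A i (Finsupp.single (j :: w) c) = lower j (raise A i (Finsupp.single w c)) +
      if i = j then cartanOp A i (Finsupp.single w c) else 0 := by
  have h1 : Finsupp.single w c = c • Finsupp.single w (1 : ℝ) := by simp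
  simp only [raise, Finsupp.linearCombination_single, raiseWord, smul_add, map_smul, smul_ite,
    smul_zero]
  rw [h1, map_smul]

theorem verma_ext {M : Type} [AddCommGroup M] [Module ℝ M] {φ ψ : Verma B →ₗ[ℝ] M}
    (h : ∀ w, φ (Finsupp.single w 1) = ψ (Finsupp.single w 1)) : φ = ψ :=
  Finsupp.lhom_ext' fun w => LinearMap.ext_ring (h w)

theorem raise_lower (i j : B) (u : Verma B) :
    raise A i (lower j u) = lower j (raise A i u) + if i = j then cartanOp A i u else 0 := by
  have : raise A i ∘ₗ lower j = lower j ∘ₗ raise A i + if i = j then cartanOp A i else 0 := by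
    refine verma_ext fun w => ?_
    by_cases hij : i = j <;> simp [raise_cons, hij]
  have h := LinearMap.congr_fun this u
  by_cases hij : i = j <;> simpa [hij] using h

theorem cartanOp_lower (i j : B) (u : Verma B) :
    cartanOp A i (lower j u) = lower j (cartanOp A i u) - (A i j : ℝ) • lower j u := by
  have : cartanOp A i ∘ₗ lower j = lower j ∘ₗ cartanOp A i - (A i j : ℝ) • lower j := by
    refine verma_ext fun w => ?_
    simp only [LinearMap.comp_apply, lower_single, cartanOp_single, LinearMap.sub_apply, map_smul,
      LinearMap.smul_apply, List.map_cons, List.sum_cons]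
    push_cast
    module
  exact LinearMap.congr_fun this u

theorem cartanOp_raise (i j : B) (u : Verma B) :
    cartanOp A i (raise A j u) = raise A j (cartanOp A i u) + (A i j : ℝ) • raise A j u := by
  have : cartanOp A i ∘ₗ raise A j = raise A j ∘ₗ cartanOp A i + (A i j : ℝ) • raise A j := by
    refine verma_ext fun w => ?_
    induction w with
    | nil => simp
    | cons k w ih =>
      simp only [LinearMap.comp_apply, LinearMap.add_apply, LinearMap.smul_apply, cartanOp_single,
        map_smul] at ih
      simp only [LinearMap.comp_apply, LinearMap.add_apply, LinearMap.smul_apply, cartanOp_single,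
        map_smul, raise_cons, map_add, cartanOp_lower, ih]
      by_cases hjk : j = k
      · subst hjk
        simp only [if_true, cartanOp_single, map_smul, List.map_cons, List.sum_cons]
        push_cast
        module
      · simp only [if_neg hjk, map_zero, List.map_cons, List.sum_cons]
        push_cast
        module
  exact LinearMap.congr_fun this u

theorem isChevalley_verma : IsChevalley A (raise A) lower (cartanOp A) where
  hh i j := by
    refine verma_ext fun w => ?_
    simp [Ring.lie_def, mul_comm]
  ef i j := by
    refine LinearMap.ext fun u => ?_
    by_cases hij : i = j <;> simp [Ring.lie_def, raise_lower, hij]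
  he i j := by
    refine LinearMap.ext fun u => ?_
    simp [Ring.lie_def, cartanOp_raise, ← Int.cast_smul_eq_zsmul ℝ]
  hf i j := by
    refine LinearMap.ext fun u => ?_
    simp [Ring.lie_def, cartanOp_lower, ← Int.cast_smul_eq_zsmul ℝ]

end

end KacMoody

namespace KacMoody

noncomputable section

set_option linter.unusedSectionVars false

variable {B : Type} [DecidableEq B] (A : Matrix B B ℤ)

namespace IsChevalley

variable {A} {L : Type} [LieRing L] [LieAlgebra ℝ L] {E F H : B → L}

theorem lie_sub_sub' (c : IsChevalley A E F H) {i j : B} (hij : i ≠ j) :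
    ⁅E i - F i, E j - F j⁆ = ⁅E i, E j⁆ + ⁅F i, F j⁆ := by
  rw [lie_sub, sub_lie, sub_lie, c.ef, ← lie_skew (F i) (E j), c.ef, ← lie_skew (F i) (F j)]
  simp [hij, Ne.symm hij, sub_eq_add_neg]

/-- Once the Serre elements in the E_i vanish, the Berman relations for E_i - F_i differ from
identities only by Serre elements in the F_i. This and the next lemma convert the former relations
into the latter. -/
theorem lie_sub_sub (c : IsChevalley A E F H) {i j : B} (hij : i ≠ j) (h0 : A i j = 0)
    (hE : serre A E i j = 0) : ⁅E i - F i, E j - F j⁆ = serre A F i j := by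
  simp only [serre, h0, neg_zero, Int.toNat_zero, pow_zero, Module.End.one_apply] at hE ⊢
  rw [c.lie_sub_sub' hij, hE, zero_add]

theorem lie_lie_sub_sub (c : IsChevalley A E F H) (hA : IsSimplyLaced A) {i j : B} (hij : i ≠ j)
    (h1 : A i j = -1) (hE : serre A E i j = 0) :
    ⁅E i - F i, ⁅E i - F i, E j - F j⁆⁆ = -(E j - F j) - serre A F i j := by
  simp only [serre, h1, neg_neg, Int.toNat_one, pow_one, LieAlgebra.ad_apply] at hE ⊢
  have h2 : ⁅E i, ⁅F i, F j⁆⁆ = F j := by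
    rw [← lie_skew, c.symm.lie_lie_E_F hA i j i hij]
    simp [Ne.symm hij, h1]
  have h3 : ⁅F i, ⁅E i, E j⁆⁆ = E j := by
    rw [← lie_skew, c.lie_lie_E_F hA i j i hij]
    simp [Ne.symm hij, h1]
  rw [c.lie_sub_sub' hij, lie_add, sub_lie, sub_lie, hE, h2, h3]
  abel

end IsChevalley

/-! ### The Serre submodule of the Verma module -/

theorem verma_eq_zero_of_commute {S : Module.End ℝ (Verma B)}
    (h0 : S (Finsupp.single [] 1) = 0) (hS : ∀ k, ⁅S, (lower k : Module.End ℝ (Verma B))⁆ = 0) :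
    S = 0 := by
  refine verma_ext fun w => ?_
  induction w with
  | nil => simpa using h0
  | cons k w ih =>
    have h1 := LinearMap.congr_fun (hS k) (Finsupp.single w 1)
    simpa [Ring.lie_def, ih] using h1

theorem serre_raise_nil (i j : B) : serre A (raise A) i j (Finsupp.single [] 1) = 0 := by
  unfold serre
  induction (-A i j).toNat with
  | zero => simp [Ring.lie_def]
  | succ n ih =>
    rw [pow_succ', Module.End.mul_apply, LieAlgebra.ad_apply, Ring.lie_def, LinearMap.sub_apply,
      Module.End.mul_apply, Module.End.mul_apply, ih, raise_nil]
    simp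

/-- The operator kills the vacuum and commutes with all lowering operators, which generate the
module from the vacuum. Only the Serre elements in the lowering operators remain to be divided out.
-/
theorem serre_raise (hA : IsSimplyLaced A) (i j : B) : serre A (raise A) i j = 0 :=
  verma_eq_zero_of_commute (serre_raise_nil A i j)
    fun k => (isChevalley_verma A).lie_serre hA i j k

/-- The span of the images of the Serre elements under at most `n` lowering operators. -/
def serreFiltration : ℕ → Submodule ℝ (Verma B)
  | 0 => ⨆ p : B × B, LinearMap.range (serre A lower p.1 p.2 : Module.End ℝ (Verma B))
  | n + 1 => serreFiltration n ⊔ ⨆ k, (serreFiltration n).map (lower k)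

theorem serreFiltration_mono : Monotone (serreFiltration A) :=
  monotone_nat_of_le_succ fun _ => le_sup_left

theorem serre_mem_serreFiltration (i j : B) (u : Verma B) :
    serre A lower i j u ∈ serreFiltration A 0 :=
  Submodule.mem_iSup_of_mem (i, j) ⟨u, rfl⟩

theorem lower_mem_serreFiltration {n : ℕ} (k : B) {u : Verma B} (hu : u ∈ serreFiltration A n) :
    lower k u ∈ serreFiltration A (n + 1) :=
  Submodule.mem_sup_right (Submodule.mem_iSup_of_mem k ⟨u, hu, rfl⟩)

theorem serreFiltration_zero_le {P : Submodule ℝ (Verma B)}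
    (h : ∀ i j u, serre A lower i j u ∈ P) : serreFiltration A 0 ≤ P := by
  refine iSup_le fun p => ?_
  rintro _ ⟨u, rfl⟩
  exact h _ _ u

theorem serreFiltration_succ_le {n : ℕ} {P : Submodule ℝ (Verma B)} (h0 : serreFiltration A n ≤ P)
    (h : ∀ k, ∀ u ∈ serreFiltration A n, lower k u ∈ P) : serreFiltration A (n + 1) ≤ P := by
  refine sup_le h0 (iSup_le fun k => ?_)
  rintro _ ⟨u, hu, rfl⟩
  exact h k u hu

theorem cartanOp_serreFiltration (k : B) (n : ℕ) :
    serreFiltration A n ≤ (serreFiltration A n).comap (cartanOp A k) := by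
  induction n with
  | zero =>
    refine serreFiltration_zero_le A fun i j u => ?_
    obtain ⟨z, hz⟩ := (isChevalley_verma A).symm.lie_H_serre i j k
    have h1 : cartanOp A k (serre A lower i j u) =
        serre A lower i j (cartanOp A k u) - z • serre A lower i j u := by
      have h2 := LinearMap.congr_fun hz u
      simp only [Pi.neg_apply, Ring.lie_def, LinearMap.neg_apply, LinearMap.sub_apply,
        Module.End.mul_apply, LinearMap.smul_apply, map_neg] at h2
      rw [← h2]
      abel
    rw [Submodule.mem_comap, h1]
    exact sub_mem (serre_mem_serreFiltration A _ _ _)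
      (zsmul_mem (serre_mem_serreFiltration A _ _ _) _)
  | succ n ih =>
    refine serreFiltration_succ_le A
      (ih.trans (Submodule.comap_mono (serreFiltration_mono A n.le_succ))) fun j u hu => ?_
    rw [Submodule.mem_comap, cartanOp_lower]
    exact sub_mem (lower_mem_serreFiltration A _ (ih hu))
      (Submodule.smul_mem _ _ (lower_mem_serreFiltration A _ hu))

/-- Raising operators commute with the Serre elements themselves; passing an outer lowering operator
adds only a Cartan term, which stays in the same level. -/
theorem raise_serreFiltration (hA : IsSimplyLaced A) (k : B) (n : ℕ) :
    serreFiltration A n ≤ (serreFiltration A n).comap (raise A k) := by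
  induction n with
  | zero =>
    refine serreFiltration_zero_le A fun i j u => ?_
    have h1 := LinearMap.congr_fun ((isChevalley_verma A).symm.lie_serre hA i j k) u
    simp only [Ring.lie_def, LinearMap.sub_apply, Module.End.mul_apply, LinearMap.zero_apply,
      sub_eq_zero] at h1
    rw [Submodule.mem_comap, ← h1]
    exact serre_mem_serreFiltration A _ _ _
  | succ n ih =>
    refine serreFiltration_succ_le A
      (ih.trans (Submodule.comap_mono (serreFiltration_mono A n.le_succ))) fun j u hu => ?_
    rw [Submodule.mem_comap, raise_lower]
    refine add_mem (lower_mem_serreFiltration A _ (ih hu)) ?_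
    split_ifs
    · exact serreFiltration_mono A n.le_succ (cartanOp_serreFiltration A k n hu)
    · exact zero_mem _

/-- The submodule generated by the images of the Serre elements. -/
def serreSubmodule : Submodule ℝ (Verma B) := ⨆ n, serreFiltration A n

theorem mem_serreSubmodule {u : Verma B} :
    u ∈ serreSubmodule A ↔ ∃ n, u ∈ serreFiltration A n :=
  Submodule.mem_iSup_of_directed _ (serreFiltration_mono A).directed_le

/-- The endomorphisms stabilising the Serre submodule. -/
def serreStabiliser : LieSubalgebra ℝ (Module.End ℝ (Verma B)) where
  carrier := {R | serreSubmodule A ≤ (serreSubmodule A).comap R}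
  add_mem' := fun hR hR' _ hu => (serreSubmodule A).add_mem (hR hu) (hR' hu)
  zero_mem' := fun _ _ => (serreSubmodule A).zero_mem
  smul_mem' := fun c _ hR _ hu => (serreSubmodule A).smul_mem c (hR hu)
  lie_mem' := fun hR hR' _ hu => (serreSubmodule A).sub_mem (hR (hR' hu)) (hR' (hR hu))

theorem raise_mem_serreStabiliser (hA : IsSimplyLaced A) (i : B) :
    raise A i ∈ serreStabiliser A := fun u hu => by
  obtain ⟨n, hn⟩ := (mem_serreSubmodule A).1 hu
  exact (mem_serreSubmodule A).2 ⟨n, raise_serreFiltration A hA i n hn⟩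

theorem cartanOp_mem_serreStabiliser (i : B) : cartanOp A i ∈ serreStabiliser A := fun u hu => by
  obtain ⟨n, hn⟩ := (mem_serreSubmodule A).1 hu
  exact (mem_serreSubmodule A).2 ⟨n, cartanOp_serreFiltration A i n hn⟩

theorem lower_mem_serreStabiliser (i : B) : lower i ∈ serreStabiliser A := fun u hu => by
  obtain ⟨n, hn⟩ := (mem_serreSubmodule A).1 hu
  exact (mem_serreSubmodule A).2 ⟨n + 1, lower_mem_serreFiltration A i hn⟩

/-- The Verma module of highest weight zero of the Kac-Moody algebra. -/
abbrev SerreVerma : Type := Verma B ⧸ serreSubmodule A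

/-- Endomorphisms stabilising the Serre submodule act on the quotient. -/
def descend : serreStabiliser A →ₗ⁅ℝ⁆ Module.End ℝ (SerreVerma A) where
  toFun R := Submodule.mapQ _ _ R.1 R.2
  map_add' R R' := by
    refine LinearMap.ext fun q => ?_
    induction q using Submodule.Quotient.induction_on
    rfl
  map_smul' c R := by
    refine LinearMap.ext fun q => ?_
    induction q using Submodule.Quotient.induction_on
    rfl
  map_lie' {R R'} := by
    refine LinearMap.ext fun q => ?_
    induction q using Submodule.Quotient.induction_on
    rfl

/-- The action of the Kac-Moody algebra on its Verma module of highest weight zero. -/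
theorem exists_verma_action (hA : IsSimplyLaced A) :
    ∃ π : Algebra A →ₗ⁅ℝ⁆ Module.End ℝ (SerreVerma A), ∀ i u,
      π (e A i) (Submodule.Quotient.mk u) = Submodule.Quotient.mk (raise A i u) ∧
      π (f A i) (Submodule.Quotient.mk u) = Submodule.Quotient.mk (lower i u) := by
  let E : B → serreStabiliser A := fun i => ⟨raise A i, raise_mem_serreStabiliser A hA i⟩
  let F : B → serreStabiliser A := fun i => ⟨lower i, lower_mem_serreStabiliser A i⟩
  let H : B → serreStabiliser A := fun i => ⟨cartanOp A i, cartanOp_mem_serreStabiliser A i⟩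
  have c := isChevalley_verma A
  have c' : IsChevalley A E F H :=
    { hh := fun i j => Subtype.ext (c.hh i j)
      ef := fun i j => Subtype.ext (by
        refine (c.ef i j).trans ?_
        split_ifs <;> rfl)
      he := fun i j => Subtype.ext (by
        refine (c.he i j).trans ?_
        simp [E])
      hf := fun i j => Subtype.ext (by
        refine (c.hf i j).trans ?_
        simp [F]) }
  have hE : ∀ i j, serre A E i j = 0 := fun i j => Subtype.ext (by
    have := map_serre A (serreStabiliser A).incl E i j
    exact this.trans (serre_raise A hA i j))
  -- These Serre relations are only claimed after descent to the quotient, where their images have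
  -- been divided out.
  have hF : ∀ i j, descend A (serre A F i j) = 0 := fun i j => by
    refine LinearMap.ext fun q => ?_
    induction q using Submodule.Quotient.induction_on with
    | H u =>
    have h1 : ((serre A F i j : serreStabiliser A) : Module.End ℝ (Verma B)) = serre A lower i j :=
      map_serre A (serreStabiliser A).incl F i j
    change Submodule.Quotient.mk (((serre A F i j : serreStabiliser A) : Module.End ℝ (Verma B)) u) = 0
    rw [h1, Submodule.Quotient.mk_eq_zero]
    exact (mem_serreSubmodule A).2 ⟨0, serre_mem_serreFiltration A i j u⟩
  obtain ⟨π, hπe, hπf⟩ := (c'.map (descend A)).exists_hom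
    (fun i j => by rw [← map_serre, hE, map_zero])
    (fun i j => by rw [← map_serre, hF])
  refine ⟨π, fun i u => ⟨?_, ?_⟩⟩
  · rw [hπe]
    rfl
  · rw [hπf]
    rfl

/-! ### Evaluation on the Verma module -/

section Evaluation

variable {M : Type} [Ring M] [_root_.Algebra ℝ M] (X : B → M)

/-- Approximations of the evaluation map, correct on words of length at most `n`. -/
def evalApprox : ℕ → Verma B →ₗ[ℝ] M
  | 0 => Finsupp.linearCombination ℝ fun w => if w = [] then 1 else 0
  | n + 1 => Finsupp.linearCombination ℝ fun
    | [] => 1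
    | j :: w => evalApprox n (raise A j (Finsupp.single w 1)) -
        X j * evalApprox n (Finsupp.single w 1)

/-- The span of the words of length at most `n`. -/
def wordFiltration (B : Type) (n : ℕ) : Submodule ℝ (Verma B) :=
  Submodule.span ℝ ((fun w => Finsupp.single w 1) '' {w : List B | w.length ≤ n})

theorem single_mem_wordFiltration {w : List B} {n : ℕ} (hw : w.length ≤ n) :
    (Finsupp.single w 1 : Verma B) ∈ wordFiltration B n :=
  Submodule.subset_span ⟨w, hw, rfl⟩

theorem raise_mem_wordFiltration (i : B) (n : ℕ) (w : List B) (hw : w.length ≤ n) :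
    raise A i (Finsupp.single w 1) ∈ wordFiltration B n := by
  induction w generalizing n with
  | nil => simp
  | cons k w ih =>
    obtain _ | n := n
    · simp at hw
    rw [raise_cons]
    have hw' : w.length ≤ n := by simpa using hw
    refine add_mem ?_ ?_
    · have : wordFiltration B n ≤ (wordFiltration B (n + 1)).comap (lower k) := by
        refine Submodule.span_le.2 ?_
        rintro _ ⟨v, hv, rfl⟩
        have hv' : v.length ≤ n := hv
        change lower k (Finsupp.single v 1) ∈ wordFiltration B (n + 1)
        rw [lower_single]
        exact single_mem_wordFiltration (by simpa using hv')
      exact this (ih n hw')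
    · split_ifs
      · rw [cartanOp_single]
        exact Submodule.smul_mem _ _ (single_mem_wordFiltration (hw'.trans n.le_succ))
      · exact zero_mem _

theorem evalApprox_succ (n : ℕ) :
    ∀ u ∈ wordFiltration B n, evalApprox A X (n + 1) u = evalApprox A X n u := by
  induction n with
  | zero =>
    intro u hu
    induction hu using Submodule.span_induction with
    | mem u hu =>
      obtain ⟨w, hw, rfl⟩ := hu
      obtain rfl : w = [] := by simpa using hw
      simp [evalApprox]
    | zero => simp
    | add u v _ _ hu hv => rw [map_add, map_add, hu, hv]
    | smul c u _ hu => rw [map_smul, map_smul, hu]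
  | succ n ih =>
    intro u hu
    induction hu using Submodule.span_induction with
    | mem u hu =>
      obtain ⟨w, hw, rfl⟩ := hu
      obtain _ | ⟨j, w⟩ := w
      · simp [evalApprox]
      · have hw' : w.length ≤ n := by simpa using hw
        have h1 := ih _ (raise_mem_wordFiltration A j n w hw')
        have h2 := ih _ (single_mem_wordFiltration hw')
        have h3 : ∀ m, evalApprox A X (m + 1) (Finsupp.single (j :: w) 1) =
            evalApprox A X m (raise A j (Finsupp.single w 1)) -
              X j * evalApprox A X m (Finsupp.single w 1) := fun m => by simp [evalApprox]
        rw [h3, h3, h1, h2]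
    | zero => simp
    | add u v _ _ hu hv => rw [map_add, map_add, hu, hv]
    | smul c u _ hu => rw [map_smul, map_smul, hu]

theorem wordFiltration_mono : Monotone (wordFiltration B) := fun _ _ hmn =>
  Submodule.span_mono (Set.image_mono fun _ (hw : _ ≤ _) => hw.trans hmn)

theorem evalApprox_eq {m n : ℕ} (hmn : m ≤ n) {u : Verma B} (hu : u ∈ wordFiltration B m) :
    evalApprox A X n u = evalApprox A X m u := by
  induction n, hmn using Nat.le_induction with
  | base => rfl
  | succ n hmn ih => rw [evalApprox_succ A X n u (wordFiltration_mono hmn hu), ih]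

/-- The evaluation map on the Verma module, the linear map with `1 ↦ 1` on which
`x_i = e_i - f_i` acts as multiplication by `X i`. -/
def eval : Verma B →ₗ[ℝ] M :=
  Finsupp.linearCombination ℝ fun w => evalApprox A X w.length (Finsupp.single w 1)

theorem eval_eq_evalApprox {n : ℕ} {u : Verma B} (hu : u ∈ wordFiltration B n) :
    eval A X u = evalApprox A X n u := by
  induction hu using Submodule.span_induction with
  | mem u hu =>
    obtain ⟨w, hw, rfl⟩ := hu
    simp only [eval, Finsupp.linearCombination_single, one_smul]
    exact (evalApprox_eq A X hw (single_mem_wordFiltration le_rfl)).symm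
  | zero => simp
  | add u v _ _ hu hv => rw [map_add, map_add, hu, hv]
  | smul c u _ hu => rw [map_smul, map_smul, hu]

theorem eval_nil : eval A X (Finsupp.single [] 1) = 1 := by
  simp [eval, evalApprox]

theorem eval_lower (j : B) (u : Verma B) :
    eval A X (lower j u) = eval A X (raise A j u) - X j * eval A X u := by
  have : eval A X ∘ₗ lower j =
      eval A X ∘ₗ raise A j - LinearMap.mulLeft ℝ (X j) ∘ₗ eval A X := by
    refine verma_ext fun w => ?_
    have h1 := eval_eq_evalApprox A X (raise_mem_wordFiltration A j w.length w le_rfl)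
    have h2 := eval_eq_evalApprox A X (single_mem_wordFiltration (le_refl w.length))
    simp only [LinearMap.comp_apply, lower_single, LinearMap.sub_apply, LinearMap.mulLeft_apply, h1,
      h2]
    simp [eval, evalApprox]
  exact LinearMap.congr_fun this u

theorem eval_raise_sub_lower (j : B) (u : Verma B) :
    eval A X ((raise A j - lower j) u) = X j * eval A X u := by
  simp [eval_lower]

/-- The defining relations of the maximal compact subalgebra of a simply laced algebra. -/
structure IsBerman : Prop where
  comm : ∀ i j, i ≠ j → A i j = 0 → ⁅X i, X j⁆ = 0
  braid : ∀ i j, A i j = -1 → ⁅X i, ⁅X i, X j⁆⁆ = -X j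

/-- Operators which act through left multiplications are closed under brackets. -/
theorem eval_lie {R R' : Module.End ℝ (Verma B)} {m m' : M}
    (h : ∀ u, eval A X (R u) = m * eval A X u) (h' : ∀ u, eval A X (R' u) = m' * eval A X u)
    (u : Verma B) : eval A X (⁅R, R'⁆ u) = ⁅m, m'⁆ * eval A X u := by
  simp [Ring.lie_def, h, h', sub_mul, mul_assoc]

variable {X}

/-- The Serre element is a Berman relation in the operators e_i - f_i, and evaluation turns it into
left multiplication by the same relation in the X_i, which holds. -/
theorem eval_serre (hA : IsSimplyLaced A) (hX : IsBerman A X) (i j : B) (u : Verma B) :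
    eval A X (serre A lower i j u) = 0 := by
  have c := isChevalley_verma A
  by_cases hij : i = j
  · subst hij
    simp [serre]
  have hx := eval_raise_sub_lower A X
  rcases hA.off i j hij with h0 | h1
  · have h2 := eval_lie A X (hx i) (hx j) u
    rw [hX.comm i j hij h0, zero_mul] at h2
    rwa [c.lie_sub_sub hij h0 (serre_raise A hA i j)] at h2
  · have h2 := eval_lie A X (hx i) (fun u => eval_lie A X (hx i) (hx j) u) u
    have h3 : ⁅raise A i - lower i, ⁅raise A i - lower i, raise A j - lower j⁆⁆ =
        -(raise A j - lower j) - serre A lower i j :=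
      c.lie_lie_sub_sub hA hij h1 (serre_raise A hA i j)
    rw [hX.braid i j h1, h3, LinearMap.sub_apply, LinearMap.neg_apply, map_sub, map_neg, hx,
      neg_mul] at h2
    simpa using h2

theorem eval_serreSubmodule (hA : IsSimplyLaced A) (hX : IsBerman A X) :
    serreSubmodule A ≤ LinearMap.ker (eval A X) := by
  refine iSup_le fun n => ?_
  induction n with
  | zero => exact serreFiltration_zero_le A fun i j u => eval_serre A hA hX i j u
  | succ n ih =>
    refine serreFiltration_succ_le A ih fun k u hu => ?_
    -- Evaluation trades the outer lowering operator for a raising one, which does not leave level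
    -- n.
    rw [LinearMap.mem_ker, eval_lower, ih (raise_serreFiltration A hA k n hu), ih hu]
    simp

/-- Berman's presentation of the maximal compact subalgebra: elements of an associative algebra
satisfying the defining relations are the images of the `x_i`. -/
theorem exists_maximalCompact_hom (hA : IsSimplyLaced A) (hX : IsBerman A X) :
    ∃ ρ : maximalCompact A →ₗ⁅ℝ⁆ M, ∀ i, ρ (x A i) = X i := by
  obtain ⟨π, hπ⟩ := exists_verma_action A hA
  let ev : SerreVerma A →ₗ[ℝ] M := Submodule.liftQ _ (eval A X) (eval_serreSubmodule A hA hX)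
  let one : SerreVerma A := Submodule.Quotient.mk (Finsupp.single [] 1)
  have ev_one : ev one = 1 := eval_nil A X
  let S : LieSubalgebra ℝ (Algebra A) :=
    { carrier := {y | ∃ m, ∀ q, ev (π y q) = m * ev q}
      add_mem' := by
        rintro y z ⟨m, hm⟩ ⟨n, hn⟩
        exact ⟨m + n, fun q => by simp [hm, hn, add_mul]⟩
      zero_mem' := ⟨0, fun q => by simp⟩
      smul_mem' := by
        rintro c y ⟨m, hm⟩
        exact ⟨c • m, fun q => by simp [hm]⟩
      lie_mem' := by
        rintro y z ⟨m, hm⟩ ⟨n, hn⟩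
        exact ⟨⁅m, n⁆, fun q => by simp [Ring.lie_def, hm, hn, sub_mul, mul_assoc]⟩ }
  have hx : ∀ i q, ev (π (x A i) q) = X i * ev q := fun i q => by
    induction q using Submodule.Quotient.induction_on with
    | H u =>
    change ev (π (e A i - f A i) _) = _
    rw [map_sub, LinearMap.sub_apply, (hπ i u).1, (hπ i u).2]
    exact (congrArg (eval A X) (LinearMap.sub_apply _ _ _).symm).trans
      (eval_raise_sub_lower A X i u)
  have hS : xSpan A ≤ S := LieSubalgebra.lieSpan_le.2 (by
    rintro _ ⟨i, rfl⟩
    exact ⟨X i, hx i⟩)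
  -- By generation y acts through `ev` as left multiplication by some element; evaluating at the
  -- vacuum identifies it. This makes y ↦ `ev (π y one)` compatible with brackets.
  have key : ∀ (y : maximalCompact A) q, ev (π y q) = ev (π y one) * ev q := fun y q => by
    obtain ⟨m, hm⟩ := hS (maximalCompact_le_xSpan A y.2)
    rw [hm, hm, ev_one, mul_one]
  refine ⟨{ toFun := fun y => ev (π y one), map_add' := ?_, map_smul' := ?_, map_lie' := ?_ }, ?_⟩
  · intro y z
    simp
  · intro c y
    simp
  · intro y z
    rw [LieSubalgebra.coe_bracket, LieHom.map_lie, Ring.lie_def, Ring.lie_def, LinearMap.sub_apply,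
      map_sub, Module.End.mul_apply, Module.End.mul_apply, key y, key z (π y one)]
  · intro i
    exact (hx i one).trans (by rw [ev_one, mul_one])

end Evaluation

end

end KacMoody

/-! ### Signs of reordered products -/

/-- Products of lists of elements which commute up to sign commute up to the product of signs. -/
theorem List.prod_mul_prod_comm_sign {ι R : Type*} [Ring R] (f : ι → R) (c : ι → ι → ℤ)
    (h : ∀ a b, f a * f b = (c a b).negOnePow • (f b * f a)) (l m : List ι) :
    (l.map f).prod * (m.map f).prod =
      ((l.map fun a => (m.map (c a)).sum).sum).negOnePow • ((m.map f).prod * (l.map f).prod) := by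
  have h1 : ∀ a, f a * (m.map f).prod = ((m.map (c a)).sum).negOnePow • ((m.map f).prod * f a) := by
    intro a
    induction m with
    | nil => simp
    | cons b m ih =>
      simp only [List.map_cons, List.prod_cons, List.sum_cons, Int.negOnePow_add]
      rw [← mul_assoc, h, smul_mul_assoc, mul_assoc, ih, mul_smul_comm, smul_smul, mul_assoc]
  induction l with
  | nil => simp
  | cons a l ih =>
    simp only [List.map_cons, List.prod_cons, List.sum_cons, Int.negOnePow_add]
    rw [mul_assoc, ih, mul_smul_comm, ← mul_assoc, h1, smul_mul_assoc, smul_smul, mul_assoc,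
      mul_comm]

namespace E10

noncomputable section

open scoped Kronecker

/-! ### Existence of gamma matrices -/

/-- The real Pauli matrices `1`, `σ₁`, `σ₃`, `iσ₂`. -/
def pauli : Fin 4 → Matrix (Fin 2) (Fin 2) ℝ :=
  ![1, !![0, 1; 1, 0], !![1, 0; 0, -1], !![0, 1; -1, 0]]

/-- Whether two real Pauli matrices anticommute. -/
def pauliSign (a b : Fin 4) : ℤ := if a = 0 ∨ b = 0 ∨ a = b then 0 else 1

theorem pauli_mul (a b : Fin 4) :
    pauli a * pauli b = (pauliSign a b).negOnePow • (pauli b * pauli a) := by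
  fin_cases a <;> fin_cases b <;> ext i j <;> fin_cases i <;> fin_cases j <;>
    simp [pauli, pauliSign, Units.smul_def]

theorem pauli_sq (a : Fin 4) :
    pauli a * pauli a = (if a = 3 then 1 else 0 : ℤ).negOnePow • 1 := by
  fin_cases a <;> ext i j <;> fin_cases i <;> fin_cases j <;>
    simp [pauli, Units.smul_def]

/-- The index type of a fivefold tensor product of two-dimensional spaces. -/
abbrev FiveBits : Type := Fin 2 × Fin 2 × Fin 2 × Fin 2 × Fin 2

/-- Fivefold tensor products of real Pauli matrices. -/
def pauliString (s : Fin 5 → Fin 4) : Matrix FiveBits FiveBits ℝ :=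
  pauli (s 0) ⊗ₖ (pauli (s 1) ⊗ₖ (pauli (s 2) ⊗ₖ (pauli (s 3) ⊗ₖ pauli (s 4))))

theorem units_smul_kronecker {m n : Type*} (u : ℤˣ) (M : Matrix m m ℝ) (N : Matrix n n ℝ) :
    (u • M) ⊗ₖ N = u • (M ⊗ₖ N) := by
  ext ⟨i, i'⟩ ⟨j, j'⟩
  simp [Units.smul_def, mul_assoc]

theorem kronecker_units_smul {m n : Type*} (u : ℤˣ) (M : Matrix m m ℝ) (N : Matrix n n ℝ) :
    M ⊗ₖ (u • N) = u • (M ⊗ₖ N) := by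
  ext ⟨i, i'⟩ ⟨j, j'⟩
  simp [Units.smul_def, mul_left_comm]

theorem pauliString_mul (s t : Fin 5 → Fin 4) :
    pauliString s * pauliString t =
      (∑ k, pauliSign (s k) (t k)).negOnePow • (pauliString t * pauliString s) := by
  simp only [pauliString, ← Matrix.mul_kronecker_mul, Fin.sum_univ_five, Int.negOnePow_add]
  rw [pauli_mul (s 0), pauli_mul (s 1), pauli_mul (s 2), pauli_mul (s 3), pauli_mul (s 4)]
  simp only [units_smul_kronecker, kronecker_units_smul, smul_smul]
  congr 1
  ac_rfl

theorem pauliString_sq (s : Fin 5 → Fin 4) :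
    pauliString s * pauliString s =
      (∑ k, if s k = 3 then 1 else 0 : ℤ).negOnePow • 1 := by
  simp only [pauliString, ← Matrix.mul_kronecker_mul, Fin.sum_univ_five, Int.negOnePow_add,
    pauli_sq, units_smul_kronecker, kronecker_units_smul, smul_smul, Matrix.one_kronecker_one]
  congr 1
  ac_rfl

/-- Ten anticommuting strings of real Pauli matrices. -/
def gammaString : Fin 10 → Fin 5 → Fin 4 :=
  ![![0, 0, 0, 0, 1], ![0, 0, 0, 0, 2], ![0, 0, 0, 3, 3], ![0, 0, 3, 1, 3], ![0, 1, 3, 2, 3],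
    ![0, 2, 3, 2, 3], ![0, 3, 0, 2, 3], ![0, 3, 1, 1, 3], ![1, 3, 2, 1, 3], ![2, 3, 2, 1, 3]]

theorem exists_isGammaSystem : ∃ Γ : Fin 10 → Matrix (Fin 32) (Fin 32) ℝ, IsGammaSystem Γ := by
  let φ := Matrix.reindexAlgEquiv ℝ ℝ (Fintype.equivFinOfCardEq (α := FiveBits) (n := 32) rfl)
  refine ⟨fun a => φ (pauliString (gammaString a)), fun a b => ?_⟩
  rw [← map_mul, ← map_mul, ← map_add]
  by_cases hab : a = b
  · subst hab
    -- Only iσ₂ squares to -1, and each string contains it an even number of times.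
    have h1 : (∑ k, if gammaString a k = 3 then 1 else 0 : ℤ).negOnePow = 1 := by
      rw [Int.negOnePow_eq_one_iff]
      revert a
      decide
    rw [pauliString_sq, h1, one_smul, if_pos rfl, one_add_one_eq_two]
    exact map_ofNat φ 2
  · have h1 : (∑ k, pauliSign (gammaString a k) (gammaString b k)).negOnePow = -1 := by
      rw [Int.negOnePow_eq_neg_one_iff]
      revert a b
      decide
    rw [pauliString_mul, h1, if_neg hab]
    simp [Units.smul_def]

/-! ### The gamma matrices of the simple roots -/

section Gamma

variable {Γ : Fin 10 → Matrix (Fin 32) (Fin 32) ℝ}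

theorem IsGammaSystem.sq (hΓ : IsGammaSystem Γ) (a : Fin 10) : Γ a * Γ a = 1 := by
  have h1 := hΓ a a
  rw [if_pos rfl, ← two_smul ℝ (Γ a * Γ a)] at h1
  have h2 := congrArg ((1 / 2 : ℝ) • ·) h1
  have h3 : (2 : Matrix (Fin 32) (Fin 32) ℝ) = (2 : ℝ) • 1 := by
    rw [two_smul, one_add_one_eq_two]
  simpa [smul_smul, h3] using h2

theorem IsGammaSystem.mul_comm_sign (hΓ : IsGammaSystem Γ) (a b : Fin 10) :
    Γ a * Γ b = (if a = b then 0 else 1 : ℤ).negOnePow • (Γ b * Γ a) := by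
  by_cases hab : a = b
  · subst hab; simp
  · have h1 := hΓ a b
    rw [if_neg hab] at h1
    simp [hab, Units.smul_def, eq_neg_of_add_eq_zero_left h1]

/-- The factors of `Γ(α_i)`. -/
def gammaFactors (i : Fin 10) : List (Fin 10) := if i = 9 then [7, 8, 9] else [i, i + 1]

theorem gammaRoot_eq_prod (Γ : Fin 10 → Matrix (Fin 32) (Fin 32) ℝ) (i : Fin 10) :
    gammaRoot Γ i = ((gammaFactors i).map Γ).prod := by
  by_cases hi : i = 9 <;> simp [gammaRoot, gammaFactors, hi, mul_assoc]

/-- The sign counts pairs of distinct gamma factors, and that count has the parity of the Cartan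
entry. -/
theorem gammaRoot_mul (hΓ : IsGammaSystem Γ) (i j : Fin 10) :
    gammaRoot Γ i * gammaRoot Γ j = (cartan i j).negOnePow • (gammaRoot Γ j * gammaRoot Γ i) := by
  rw [gammaRoot_eq_prod, gammaRoot_eq_prod, List.prod_mul_prod_comm_sign Γ _ hΓ.mul_comm_sign]
  congr 1
  rw [Int.negOnePow_eq_iff]
  revert i j
  decide

theorem gammaRoot_sq (hΓ : IsGammaSystem Γ) (i : Fin 10) : gammaRoot Γ i * gammaRoot Γ i = -1 := by
  have hab : ∀ a b : Fin 10, a ≠ b → Γ a * Γ b * (Γ a * Γ b) = -1 := fun a b hab => by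
    have h1 := hΓ.mul_comm_sign b a
    rw [if_neg hab.symm, Int.negOnePow_one, Units.neg_smul, one_smul] at h1
    rw [mul_assoc, ← mul_assoc (Γ b), h1, neg_mul, mul_neg, mul_assoc, hΓ.sq, mul_one, hΓ.sq]
  by_cases hi : i = 9
  -- Γ₇ commutes with Γ₈Γ₉, so the square of the triple product is Γ₇²(Γ₈Γ₉)².
  · have h1 := List.prod_mul_prod_comm_sign Γ _ hΓ.mul_comm_sign [7] [8, 9]
    simp only [List.map_cons, List.map_nil, List.prod_cons, List.prod_nil, List.sum_cons,
      List.sum_nil, mul_one] at h1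
    rw [show (((if (7 : Fin 10) = 8 then 0 else 1) + ((if (7 : Fin 10) = 9 then 0 else 1) + 0) + 0 :
      ℤ)).negOnePow = 1 from rfl, one_smul] at h1
    rw [gammaRoot, if_pos hi, mul_assoc (Γ 7)]
    calc Γ 7 * (Γ 8 * Γ 9) * (Γ 7 * (Γ 8 * Γ 9))
        = Γ 7 * (Γ 8 * Γ 9 * Γ 7) * (Γ 8 * Γ 9) := by simp only [mul_assoc]
      _ = Γ 7 * Γ 7 * (Γ 8 * Γ 9 * (Γ 8 * Γ 9)) := by rw [← h1]; simp only [mul_assoc]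
      _ = -1 := by rw [hΓ.sq, hab 8 9 (by decide), one_mul]
  · rw [gammaRoot, if_neg hi]
    exact hab _ _ (by revert i; decide)

theorem ne_zero_of_sq {g : Matrix (Fin 32) (Fin 32) ℝ} (hg : g * g = -1) : g ≠ 0 := by
  rintro rfl
  simp at hg

end Gamma

/-! ### Dyads -/

/-- Covectors on the ten-dimensional space. -/
abbrev Covector : Type := Fin 10 → ℝ

/-- The DeWitt bilinear form on covectors. -/
def form : LinearMap.BilinForm ℝ Covector := Matrix.toBilin' deWitt

theorem form_apply (x y : Covector) : form x y = ∑ a, x a * y a - 1 / 9 * (∑ a, x a) * ∑ a, y a := by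
  simp only [form, Matrix.toBilin'_apply, deWitt, Matrix.of_apply, mul_sub, sub_mul,
    Finset.sum_sub_distrib]
  congr 1
  · simp
  · rw [mul_assoc, Finset.sum_mul_sum, Finset.mul_sum]
    refine Finset.sum_congr rfl fun a _ => ?_
    rw [Finset.mul_sum]
    exact Finset.sum_congr rfl fun b _ => by ring

theorem form_comm (x y : Covector) : form x y = form y x := by
  rw [form_apply, form_apply]
  simp only [mul_comm]
  ring

/-- The matrix `x^a y_b`, the first index of which is raised by the DeWitt metric. -/
def dyad : Covector →ₗ[ℝ] Covector →ₗ[ℝ] Matrix (Fin 10) (Fin 10) ℝ :=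
  LinearMap.mk₂ ℝ (fun x y => Matrix.vecMulVec (deWitt.mulVec x) y)
    (fun x x' y => by rw [Matrix.mulVec_add, Matrix.add_vecMulVec])
    (fun c x y => by rw [Matrix.mulVec_smul, Matrix.smul_vecMulVec])
    (fun x y y' => Matrix.vecMulVec_add _ _ _)
    (fun c x y => Matrix.vecMulVec_smul _ _ _)

theorem dyad_apply (x y : Covector) : dyad x y = Matrix.vecMulVec (deWitt.mulVec x) y := rfl

theorem dyad_mul_dyad (x y z w : Covector) : dyad x y * dyad z w = form y z • dyad x w := by
  rw [dyad_apply, dyad_apply, Matrix.vecMulVec_mul_vecMulVec, Matrix.vecMulVec_smul, form,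
    Matrix.toBilin'_apply', dyad_apply]

/-- The simple roots with integer components. -/
def simpleRootInt (i : Fin 10) : Fin 10 → ℤ :=
  if i = 9 then Pi.single 7 1 + Pi.single 8 1 + Pi.single 9 1
  else Pi.single i 1 - Pi.single (i + 1) 1

theorem simpleRoot_eq_intCast (i a : Fin 10) : simpleRoot i a = simpleRootInt i a := by
  by_cases hi : i = 9 <;> simp [simpleRoot, simpleRootInt, hi, Pi.single_apply]

theorem form_simpleRoot (i j : Fin 10) : form (simpleRoot i) (simpleRoot j) = cartan i j := by
  -- Multiplying by 9 clears the denominator of the metric and makes the claim decidable over the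
  -- integers.
  have h1 : ∀ i j, 9 * ∑ a, simpleRootInt i a * simpleRootInt j a -
      (∑ a, simpleRootInt i a) * ∑ a, simpleRootInt j a = 9 * cartan i j := by decide
  have h2 := congrArg (Int.cast (R := ℝ)) (h1 i j)
  push_cast at h2
  rw [form_apply]
  simp only [simpleRoot_eq_intCast]
  linarith

/-- The matrix `P(x) = -2 X(x)`. -/
def polar (x : Covector) : Matrix (Fin 10) (Fin 10) ℝ := dyad x x - (1 / 2 : ℝ) • 1

theorem neg_two_smul_polarisation (i : Fin 10) :
    (-2 : ℝ) • polarisation i = polar (simpleRoot i) := by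
  rw [polarisation, polar, dyad_apply]
  module

theorem dyad_sq {x : Covector} (hx : form x x = 2) :
    dyad x x * dyad x x = (2 : ℝ) • dyad x x := by
  rw [dyad_mul_dyad, hx]

theorem dyad_mul_polar_mul_dyad {x y : Covector} (hx : form x x = 2) :
    dyad x x * polar y * dyad x x = (form x y ^ 2 - 1) • dyad x x := by
  simp only [polar, mul_sub, sub_mul, mul_smul_comm, smul_mul_assoc, mul_one, dyad_mul_dyad, hx,
    smul_smul, form_comm y x]
  module

/-- The square of the anticommutator with `P(x)`. -/
theorem polar_anti_anti {x : Covector} (hx : form x x = 2) (M : Matrix (Fin 10) (Fin 10) ℝ) :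
    polar x * (polar x * M + M * polar x) + (polar x * M + M * polar x) * polar x =
      (2 : ℝ) • (dyad x x * M * dyad x x) + M := by
  -- With L and R the left and right multiplications by the dyad, L² = 2L and R² = 2R give (L + R -
  -- 1)² = 2LR + 1.
  have h1 : dyad x x * (dyad x x * M) = (2 : ℝ) • (dyad x x * M) := by
    rw [← mul_assoc, dyad_sq hx, smul_mul_assoc]
  simp only [polar, mul_sub, sub_mul, mul_add, add_mul, mul_smul_comm, smul_mul_assoc, mul_one,
    one_mul, mul_assoc, dyad_sq hx, h1]
  module

/-- The square of the commutator with `P(x)`. -/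
theorem polar_comm_comm {x : Covector} (hx : form x x = 2) (M : Matrix (Fin 10) (Fin 10) ℝ) :
    polar x * (polar x * M - M * polar x) - (polar x * M - M * polar x) * polar x =
      (2 : ℝ) • (M - (1 - dyad x x) * M * (1 - dyad x x)) := by
  -- In the same notation, (L - R)² = 2(1 - (1 - L)(1 - R)).
  have h1 : dyad x x * (dyad x x * M) = (2 : ℝ) • (dyad x x * M) := by
    rw [← mul_assoc, dyad_sq hx, smul_mul_assoc]
  simp only [polar, mul_sub, sub_mul, mul_smul_comm, smul_mul_assoc, mul_one,
    one_mul, mul_assoc, dyad_sq hx, h1]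
  module

/-- The two products supply the cross terms of the dyad of x + y. The overall minus sign is the
source of the signs in `IsRealised`. -/
theorem polar_anti {x y : Covector} (hxy : form x y = -1) :
    polar x * polar y + polar y * polar x = -polar (x + y) := by
  simp only [polar, mul_sub, sub_mul, mul_smul_comm, smul_mul_assoc, mul_one, one_mul,
    dyad_mul_dyad, hxy, form_comm y x, map_add, LinearMap.add_apply]
  module

theorem polar_comm {x y : Covector} (hxy : form x y = 0) :
    polar x * polar y - polar y * polar x = 0 := by
  simp only [polar, mul_sub, sub_mul, mul_smul_comm, smul_mul_assoc, mul_one, one_mul,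
    dyad_mul_dyad, hxy, form_comm y x]
  module

/-! ### Brackets of tensor products -/

section Bracket

variable {m n : Type} [Fintype m] [Fintype n] [DecidableEq m] [DecidableEq n]
  {M N : Matrix m m ℝ} {g h : Matrix n n ℝ}

theorem lie_kronecker_of_anti (hgh : h * g = -(g * h)) :
    ⁅M ⊗ₖ g, N ⊗ₖ h⁆ = (M * N + N * M) ⊗ₖ (g * h) := by
  rw [Ring.lie_def, ← Matrix.mul_kronecker_mul, ← Matrix.mul_kronecker_mul, hgh,
    Matrix.add_kronecker, ← neg_one_smul ℝ (g * h), Matrix.kronecker_smul]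
  module

theorem lie_kronecker_of_comm (hgh : h * g = g * h) :
    ⁅M ⊗ₖ g, N ⊗ₖ h⁆ = (M * N - N * M) ⊗ₖ (g * h) := by
  rw [Ring.lie_def, ← Matrix.mul_kronecker_mul, ← Matrix.mul_kronecker_mul, hgh,
    sub_eq_add_neg (M * N), Matrix.add_kronecker, ← neg_one_smul ℝ (N * M), Matrix.smul_kronecker]
  module

theorem lie_lie_kronecker_of_anti (hg : g * g = -1) (hgh : h * g = -(g * h)) :
    ⁅M ⊗ₖ g, ⁅M ⊗ₖ g, N ⊗ₖ h⁆⁆ =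
      -((M * (M * N + N * M) + (M * N + N * M) * M) ⊗ₖ h) := by
  have h1 : g * h * g = -(g * (g * h)) := by rw [mul_assoc, hgh, mul_neg]
  rw [lie_kronecker_of_anti hgh, lie_kronecker_of_anti h1, ← mul_assoc, hg, neg_one_mul,
    ← neg_one_smul ℝ h, Matrix.kronecker_smul, neg_one_smul]

theorem lie_lie_kronecker_of_comm (hg : g * g = -1) (hgh : h * g = g * h) :
    ⁅M ⊗ₖ g, ⁅M ⊗ₖ g, N ⊗ₖ h⁆⁆ =
      -((M * (M * N - N * M) - (M * N - N * M) * M) ⊗ₖ h) := by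
  have h1 : g * h * g = g * (g * h) := by rw [mul_assoc, hgh]
  rw [lie_kronecker_of_comm hgh, lie_kronecker_of_comm h1, ← mul_assoc, hg, neg_one_mul,
    ← neg_one_smul ℝ h, Matrix.kronecker_smul, neg_one_smul]

theorem lie_lie_of_anti (hg : g * g = -1) (hgh : h * g = -(g * h)) :
    ⁅(1 / 2 : ℝ) • g, ⁅(1 / 2 : ℝ) • g, (1 / 2 : ℝ) • h⁆⁆ = -((1 / 2 : ℝ) • h) := by
  have h1 : g * (g * h) = -h := by rw [← mul_assoc, hg, neg_one_mul]
  have h2 : g * h * g = h := by rw [mul_assoc, hgh, mul_neg, h1, neg_neg]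
  have h3 : h * g * g = -h := by rw [mul_assoc, hg, mul_neg, mul_one]
  simp only [Ring.lie_def, mul_sub, sub_mul, mul_smul_comm, smul_mul_assoc, smul_smul]
  rw [h1, ← mul_assoc g h g, h2, h3]
  module

end Bracket

/-! ### Existence and uniqueness of the two representations -/

theorem isSimplyLaced_cartan : KacMoody.IsSimplyLaced cartan where
  diag := by decide
  symm := by simpa only [sub_eq_zero] using
    (by decide : ∀ i j : Fin 10, cartan i j - cartan j i = 0)
  off := by simpa only [add_zero, add_eq_zero_iff_eq_neg] using
    (by decide : ∀ i j : Fin 10, i ≠ j → cartan i j + 0 = 0 ∨ cartan i j + 1 = 0)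

variable {Γ : Fin 10 → Matrix (Fin 32) (Fin 32) ℝ}

theorem gammaRoot_comm (hΓ : IsGammaSystem Γ) {i j : Fin 10} (hij : cartan j i = 0) :
    gammaRoot Γ j * gammaRoot Γ i = gammaRoot Γ i * gammaRoot Γ j := by
  rw [gammaRoot_mul hΓ, hij, Int.negOnePow_zero, one_smul]

theorem gammaRoot_anti (hΓ : IsGammaSystem Γ) {i j : Fin 10} (hij : cartan j i = -1) :
    gammaRoot Γ j * gammaRoot Γ i = -(gammaRoot Γ i * gammaRoot Γ j) := by
  rw [gammaRoot_mul hΓ, hij, Int.negOnePow_neg, Int.negOnePow_one, Units.neg_smul, one_smul]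

theorem isBerman_half (hΓ : IsGammaSystem Γ) :
    KacMoody.IsBerman cartan fun i => (1 / 2 : ℝ) • gammaRoot Γ i where
  comm i j _ h0 := by
    have h1 := gammaRoot_comm hΓ (h0 ▸ isSimplyLaced_cartan.symm j i)
    simp only [Ring.lie_def, mul_smul_comm, smul_mul_assoc, h1, sub_self]
  braid i j h0 := lie_lie_of_anti (gammaRoot_sq hΓ i)
    (gammaRoot_anti hΓ (h0 ▸ isSimplyLaced_cartan.symm j i))

theorem form_simpleRoot_self (i : Fin 10) : form (simpleRoot i) (simpleRoot i) = 2 := by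
  rw [form_simpleRoot, isSimplyLaced_cartan.diag]
  norm_num

/-- In the braid relation the extra dyad has coefficient (α_i|α_j)² - 1, which is zero for adjacent
simple roots. Its failure to vanish for larger odd pairings is what separates the two kernels. -/
theorem isBerman_threeHalves (hΓ : IsGammaSystem Γ) :
    KacMoody.IsBerman cartan fun i => polar (simpleRoot i) ⊗ₖ gammaRoot Γ i where
  comm i j _ h0 := by
    rw [lie_kronecker_of_comm (gammaRoot_comm hΓ (h0 ▸ isSimplyLaced_cartan.symm j i)),
      polar_comm (by rw [form_simpleRoot, h0, Int.cast_zero]), Matrix.zero_kronecker]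
  braid i j h0 := by
    rw [lie_lie_kronecker_of_anti (gammaRoot_sq hΓ i)
      (gammaRoot_anti hΓ (h0 ▸ isSimplyLaced_cartan.symm j i)),
      polar_anti_anti (form_simpleRoot_self i),
      dyad_mul_polar_mul_dyad (form_simpleRoot_self i), form_simpleRoot, h0]
    norm_num

theorem isSpinThreeHalves_iff {ρ : K →ₗ⁅ℝ⁆ Matrix (Fin 10 × Fin 32) (Fin 10 × Fin 32) ℝ} :
    IsSpinThreeHalves Γ ρ ↔
      ∀ i, ρ (KacMoody.x cartan i) = polar (simpleRoot i) ⊗ₖ gammaRoot Γ i := by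
  simp only [IsSpinThreeHalves, ← Matrix.smul_kronecker, neg_two_smul_polarisation]

theorem existsUnique_spinHalf (hΓ : IsGammaSystem Γ) : ∃! ρ, IsSpinHalf Γ ρ := by
  obtain ⟨ρ, hρ⟩ := KacMoody.exists_maximalCompact_hom cartan isSimplyLaced_cartan (isBerman_half hΓ)
  exact ⟨ρ, hρ, fun ρ' h' => KacMoody.maximalCompact_hom_ext cartan fun i => (h' i).trans (hρ i).symm⟩

theorem existsUnique_spinThreeHalves (hΓ : IsGammaSystem Γ) : ∃! ρ, IsSpinThreeHalves Γ ρ := by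
  obtain ⟨ρ, hρ⟩ :=
    KacMoody.exists_maximalCompact_hom cartan isSimplyLaced_cartan (isBerman_threeHalves hΓ)
  have hρ' := isSpinThreeHalves_iff.2 hρ
  exact ⟨ρ, hρ', fun ρ' h' =>
    KacMoody.maximalCompact_hom_ext cartan fun i => (h' i).trans (hρ' i).symm⟩

end

end E10

namespace E10

noncomputable section

open scoped Kronecker

/-! ### Symmetric bilinear maps invariant under the stabiliser of a simple root -/

/-- The basis covectors. -/
def basisCovector (a : Fin 10) : Covector := Pi.single a 1


/-- The reflection in a root. -/
def reflect (z : Covector) : Covector →ₗ[ℝ] Covector :=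
  LinearMap.id - (form z).smulRight z

theorem reflect_apply (z x : Covector) : reflect z x = x - form z x • z := rfl

/-- The null root `δ`. -/
def nullRoot : Covector := ∑ a ∈ Finset.univ.erase 0, basisCovector a

theorem sum_basisCovector (a : Fin 10) : ∑ b, basisCovector a b = 1 := by
  simp [basisCovector]

theorem form_basisCovector (x : Covector) (a : Fin 10) :
    form x (basisCovector a) = x a - 1 / 9 * ∑ b, x b := by
  rw [form_apply, sum_basisCovector]
  simp [basisCovector, Pi.single_apply]

theorem reflect_line_basisCovector (i a : Fin 10) (hi : i ≠ 9) :
    reflect (simpleRoot i) (basisCovector a) = basisCovector (Equiv.swap i (i + 1) a) := by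
  have hi' : i ≠ i + 1 := by revert i; decide
  rw [reflect_apply, form_basisCovector, simpleRoot, if_neg hi]
  have h1 : ∑ b, (Pi.single i 1 - Pi.single (i + 1) 1 : Covector) b = 0 := by
    simp [Finset.sum_sub_distrib]
  rw [h1]
  rcases eq_or_ne a i with rfl | ha
  · rw [Equiv.swap_apply_left]
    simp [basisCovector, hi']
  · rcases eq_or_ne a (i + 1) with rfl | ha'
    · rw [Equiv.swap_apply_right]
      simp [basisCovector, hi'.symm]
    · rw [Equiv.swap_apply_of_ne_of_ne ha ha']
      simp [basisCovector, ha, ha']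

theorem reflect_exceptional_basisCovector (a : Fin 10) :
    reflect (simpleRoot 9) (basisCovector a) = basisCovector a -
      ((if 7 ≤ a then 1 else 0) - 1 / 3 : ℝ) •
        (basisCovector 7 + basisCovector 8 + basisCovector 9) := by
  rw [reflect_apply, form_basisCovector, simpleRoot, if_pos rfl]
  have h1 : ∑ b, (Pi.single 7 1 + Pi.single 8 1 + Pi.single 9 1 : Covector) b = 3 := by
    simp [Finset.sum_add_distrib]
    norm_num
  rw [h1]
  congr 2
  fin_cases a <;> simp <;> norm_num

section Invariant

variable {W : Type} [AddCommGroup W] [Module ℝ W] (b : Covector →ₗ[ℝ] Covector →ₗ[ℝ] W)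

/-- The hypotheses on the vanishing set of a symmetric bilinear map which force it to be zero. -/
structure IsRootInvariant : Prop where
  symm : ∀ x y, b x y = b y x
  -- α_1 is the only simple root with odd pairing with α_0; for it the double bracket does not act
  -- by a reflection.
  reflect_simple : ∀ i, i ≠ 1 → ∀ x y, b x y = 0 →
    b (reflect (simpleRoot i) x) (reflect (simpleRoot i) y) = 0
  reflect_root : ∀ x y, b x y = 0 →
    b (reflect (nullRoot + simpleRoot 1) x) (reflect (nullRoot + simpleRoot 1) y) = 0
  root_one : b (simpleRoot 1) (simpleRoot 1) = 0
  root_two : b ((2 : ℝ) • nullRoot + simpleRoot 1) ((2 : ℝ) • nullRoot + simpleRoot 1) = 0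

namespace IsRootInvariant

variable {b}

/-- The permutation of coordinates as a linear map. -/
def swapMap (a c : Fin 10) : Covector →ₗ[ℝ] Covector := LinearMap.funLeft ℝ ℝ (Equiv.swap a c)

theorem swapMap_basisCovector (a c d : Fin 10) :
    swapMap a c (basisCovector d) = basisCovector (Equiv.swap a c d) := by
  ext k
  simp only [swapMap, LinearMap.funLeft_apply, basisCovector, Pi.single_apply]
  congr 1
  rw [Equiv.swap_apply_eq_iff]

theorem swapMap_swapMap (a c d e : Fin 10) (x : Covector) :
    swapMap a c (swapMap d e (swapMap a c x)) =
      swapMap (Equiv.swap a c d) (Equiv.swap a c e) x := by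
  ext k
  simp only [swapMap, LinearMap.funLeft_apply]
  congr 1
  rw [Equiv.swap_apply_apply]
  simp

theorem reflect_eq_swapMap (i : Fin 10) (hi : i ≠ 9) :
    reflect (simpleRoot i) = swapMap i (i + 1) := by
  refine LinearMap.pi_ext' fun a => LinearMap.ext_ring ?_
  exact (reflect_line_basisCovector i a hi).trans (swapMap_basisCovector i (i + 1) a).symm

theorem swap_adjacent (hb : IsRootInvariant b) (i : Fin 10) (hi : i ≠ 9) (hi' : i ≠ 1)
    {x y : Covector} (h : b x y = 0) : b (swapMap i (i + 1) x) (swapMap i (i + 1) y) = 0 := by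
  rw [← reflect_eq_swapMap i hi]
  exact hb.reflect_simple i hi' x y h

/-- Induction by conjugation, (a d+1) = (d d+1)(a d)(d d+1). The bound 2 ≤ a avoids the excluded
reflection in α_1, which swaps 1 and 2. -/
theorem swap_of_lt (hb : IsRootInvariant b) (n : ℕ) : ∀ (a c : Fin 10), 2 ≤ a → c.val = a.val + n + 1 →
    ∀ x y, b x y = 0 → b (swapMap a c x) (swapMap a c y) = 0 := by
  induction n with
  | zero =>
    intro a c ha hc x y h
    have hc' : c = a + 1 := by omega
    subst hc'
    exact hb.swap_adjacent a (by omega) (by omega) h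
  | succ n ih =>
    intro a c ha hc x y h
    obtain ⟨d, hd⟩ : ∃ d : Fin 10, d.val = a.val + n + 1 := ⟨⟨a.val + n + 1, by omega⟩, rfl⟩
    have hdc : c = d + 1 := by omega
    have h1 : Equiv.swap d c a = a := Equiv.swap_apply_of_ne_of_ne (by omega) (by omega)
    have h2 := swapMap_swapMap d c a d
    rw [h1, Equiv.swap_apply_left] at h2
    rw [← h2, ← h2]
    subst hdc
    exact hb.swap_adjacent d (by omega) (by omega)
      (ih a d ha hd _ _ (hb.swap_adjacent d (by omega) (by omega) h))

theorem swap (hb : IsRootInvariant b) {a c : Fin 10} (ha : 2 ≤ a) (hc : 2 ≤ c) {x y : Covector}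
    (h : b x y = 0) : b (swapMap a c x) (swapMap a c y) = 0 := by
  rcases lt_trichotomy a c with hac | rfl | hac
  · exact hb.swap_of_lt (c.val - a.val - 1) a c ha (by omega) x y h
  · simpa [swapMap, Equiv.swap_self] using h
  · rw [swapMap, Equiv.swap_comm]
    exact hb.swap_of_lt (a.val - c.val - 1) c a hc (by omega) x y h

theorem nullRoot_eq : nullRoot = basisCovector 1 + basisCovector 2 + basisCovector 3 +
    basisCovector 4 + basisCovector 5 + basisCovector 6 + basisCovector 7 + basisCovector 8 +
    basisCovector 9 := by
  have : (Finset.univ.erase 0 : Finset (Fin 10)) = {1, 2, 3, 4, 5, 6, 7, 8, 9} := by decide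
  rw [nullRoot, this]
  simp [add_assoc]

theorem simpleRoot_one_eq : simpleRoot 1 = basisCovector 1 - basisCovector 2 := by
  simp [simpleRoot, basisCovector]

/-- δ is orthogonal to the simple roots of the affine subdiagram, nodes 1 to 9. -/
theorem reflect_nullRoot (i : Fin 10) (hi : i ≠ 0) : reflect (simpleRoot i) nullRoot = nullRoot := by
  by_cases hi' : i = 9
  · subst hi'
    simp only [nullRoot_eq, map_add, reflect_exceptional_basisCovector]
    simp
    module
  · rw [nullRoot, map_sum]
    simp only [reflect_line_basisCovector _ _ hi']
    refine Finset.sum_equiv (Equiv.swap i (i + 1)) (fun a => ?_) (fun a _ => rfl)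
    simp only [Finset.mem_erase, Finset.mem_univ, and_true]
    rw [not_iff_not]
    revert i a
    decide

theorem swapMap_nullRoot {a c : Fin 10} (ha : a ≠ 0) (hc : c ≠ 0) :
    swapMap a c nullRoot = nullRoot := by
  rw [nullRoot, map_sum]
  simp only [swapMap_basisCovector]
  refine Finset.sum_equiv (Equiv.swap a c) (fun d => ?_) (fun d _ => rfl)
  simp only [Finset.mem_erase, Finset.mem_univ, and_true]
  rw [not_iff_not]
  revert a c d
  decide

/-! ### Pairing with the null root. -/

theorem null_add_root (hb : IsRootInvariant b) : b nullRoot (nullRoot + simpleRoot 1) = 0 := by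
  have h1 := hb.root_one
  have h2 := hb.root_two
  simp only [map_add, map_smul, LinearMap.add_apply, LinearMap.smul_apply] at h2 ⊢
  rw [hb.symm (simpleRoot 1)] at h2
  -- The value at 2δ + α_1 expands to 4b(δ, δ) + 4b(δ, α_1) + b(α_1, α_1).
  linear_combination (norm := module) (1 / 4 : ℝ) • (h2 - h1)

/-- The reflection in α_2 fixes δ and sends e^1 - e^2 to e^1 - e^3; subtracting the two vanishing
values gives c = 3, and swaps give the rest. -/
theorem null_sub (hb : IsRootInvariant b) {c : Fin 10} (hc : 3 ≤ c) :
    b nullRoot (basisCovector 2 - basisCovector c) = 0 := by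
  have h1 := hb.null_add_root
  have h2 := hb.reflect_simple 2 (by decide) _ _ h1
  have h3 : b nullRoot (basisCovector 2 - basisCovector 3) = 0 := by
    simp only [simpleRoot_one_eq, map_add, map_sub, reflect_nullRoot 2 (by decide),
      reflect_line_basisCovector 2 _ (by decide)] at h1 h2
    rw [show Equiv.swap (2 : Fin 10) (2 + 1) 1 = 1 by decide,
      show Equiv.swap (2 : Fin 10) (2 + 1) 2 = 3 by decide] at h2
    rw [map_sub]
    linear_combination (norm := module) h2 - h1
  have h4 := hb.swap (a := 3) (c := c) (by decide) (le_trans (by decide) hc) h3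
  rw [swapMap_nullRoot (by decide) (by omega), map_sub, swapMap_basisCovector,
    swapMap_basisCovector, Equiv.swap_apply_left,
    Equiv.swap_apply_of_ne_of_ne (by decide) (by omega)] at h4
  exact h4

theorem null_basis (hb : IsRootInvariant b) {a : Fin 10} (ha : 2 ≤ a) :
    b nullRoot (basisCovector a) = 0 := by
  have h7 := hb.null_sub (c := 7) (by decide)
  have h8 := hb.null_sub (c := 8) (by decide)
  have h9 := hb.null_sub (c := 9) (by decide)
  have h1 := hb.reflect_simple 9 (by decide) _ _ h9
  have h2 : b nullRoot (basisCovector 2) = 0 := by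
    simp only [reflect_nullRoot 9 (by decide), map_sub, map_add, map_smul,
      reflect_exceptional_basisCovector, show ¬ (7 : Fin 10) ≤ 2 by decide, if_false,
      show (7 : Fin 10) ≤ 9 by decide, if_true] at h1 h7 h8 h9 ⊢
    -- The reflection in α_9 sends e^2 - e^9 to e^2 + e^7 + e^8; adding e^2 - e^7 and e^2 - e^8
    -- leaves 3e^2.
    linear_combination (norm := module) (1 / 3 : ℝ) • (h1 + h7 + h8)
  by_cases ha' : a = 2
  · rw [ha', h2]
  · have h3 := hb.null_sub (c := a) (by omega)
    rw [map_sub, h2] at h3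
    simpa using h3

theorem null_one (hb : IsRootInvariant b) : b nullRoot (basisCovector 1) = 0 := by
  have h1 := hb.null_add_root
  have h2 : b nullRoot nullRoot = b nullRoot (basisCovector 1) := by
    conv_lhs => arg 2; rw [nullRoot_eq]
    simp only [map_add]
    rw [hb.null_basis (a := 2) (by decide), hb.null_basis (a := 3) (by decide),
      hb.null_basis (a := 4) (by decide), hb.null_basis (a := 5) (by decide),
      hb.null_basis (a := 6) (by decide), hb.null_basis (a := 7) (by decide),
      hb.null_basis (a := 8) (by decide), hb.null_basis (a := 9) (by decide)]
    simp
  rw [map_add, h2, simpleRoot_one_eq, map_sub, hb.null_basis (a := 2) (by decide)] at h1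
  linear_combination (norm := module) (1 / 2 : ℝ) • h1

theorem null_eq_zero (hb : IsRootInvariant b) (x : Covector) (hx : x 0 = 0) : b nullRoot x = 0 := by
  rw [← Finset.univ_sum_single x, map_sum]
  refine Finset.sum_eq_zero fun a _ => ?_
  have h1 : (Pi.single a (x a) : Covector) = x a • basisCovector a := by
    simp [basisCovector, ← Pi.single_smul]
  rw [h1, map_smul]
  rcases eq_or_ne a 0 with rfl | h0
  · rw [hx, zero_smul]
  · rcases eq_or_ne a 1 with rfl | h1
    · rw [hb.null_one, smul_zero]
    · rw [hb.null_basis (by omega), smul_zero]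

/-! ### Isotropic roots of E₈ and isotropic basis covectors. -/

theorem highest_highest (hb : IsRootInvariant b) :
    b (nullRoot - simpleRoot 1) (nullRoot - simpleRoot 1) = 0 := by
  have h1 := hb.null_eq_zero nullRoot (by simp [nullRoot_eq, basisCovector])
  have h2 := hb.null_eq_zero (simpleRoot 1) (by simp [simpleRoot_one_eq, basisCovector])
  rw [map_sub, map_sub, LinearMap.sub_apply, LinearMap.sub_apply, h1, h2, hb.symm, h2, hb.root_one]
  simp

/-- Isotropy is preserved by exchanging two coordinates. -/
theorem swap_diag (hb : IsRootInvariant b) {a c : Fin 10} (ha : 2 ≤ a) (hc : 2 ≤ c)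
    {x y : Covector} (hxy : swapMap a c x = y) (h : b x x = 0) : b y y = 0 :=
  hxy ▸ hb.swap ha hc h

theorem reflect_diag (hb : IsRootInvariant b) {x y : Covector}
    (hxy : reflect (simpleRoot 9) x = y) (h : b x x = 0) : b y y = 0 :=
  hxy ▸ hb.reflect_simple 9 (by decide) _ _ h

/-- δ - α_1 is the highest root of E₈, and all simple reflections of E₈ are available. The exchanges
and two reflections in α_9 carry it to roots with 8, then 6, then 3 nonzero coordinates. -/
theorem triple_diag (hb : IsRootInvariant b) :
    b (basisCovector 6 + basisCovector 8 + basisCovector 9)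
      (basisCovector 6 + basisCovector 8 + basisCovector 9) = 0 := by
  have h1 : b (basisCovector 2 + basisCovector 3 + basisCovector 4 + basisCovector 5 +
      basisCovector 6 + basisCovector 7 + basisCovector 8 + (2 : ℝ) • basisCovector 9)
      (basisCovector 2 + basisCovector 3 + basisCovector 4 + basisCovector 5 +
      basisCovector 6 + basisCovector 7 + basisCovector 8 + (2 : ℝ) • basisCovector 9) = 0 := by
    refine hb.swap_diag (a := 2) (c := 9) (by decide) (by decide) ?_ hb.highest_highest
    simp [nullRoot_eq, simpleRoot_one_eq, swapMap_basisCovector, Equiv.swap_apply_def]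
    module
  have h2 : b (basisCovector 2 + basisCovector 3 + basisCovector 4 + basisCovector 5 +
      basisCovector 6 + basisCovector 9) (basisCovector 2 + basisCovector 3 + basisCovector 4 +
      basisCovector 5 + basisCovector 6 + basisCovector 9) = 0 := by
    refine hb.reflect_diag ?_ h1
    simp [reflect_exceptional_basisCovector]
    module
  have h3 : b (basisCovector 7 + basisCovector 8 + basisCovector 4 + basisCovector 5 +
      basisCovector 6 + basisCovector 9) (basisCovector 7 + basisCovector 8 + basisCovector 4 +
      basisCovector 5 + basisCovector 6 + basisCovector 9) = 0 := by
    refine hb.swap_diag (a := 2) (c := 7) (by decide) (by decide) ?_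
      (hb.swap_diag (a := 3) (c := 8) (by decide) (by decide) rfl h2)
    simp [swapMap_basisCovector, Equiv.swap_apply_def]
  have h4 : b (basisCovector 4 + basisCovector 5 + basisCovector 6)
      (basisCovector 4 + basisCovector 5 + basisCovector 6) = 0 := by
    refine hb.reflect_diag ?_ h3
    simp [reflect_exceptional_basisCovector]
    module
  refine hb.swap_diag (a := 4) (c := 8) (by decide) (by decide) ?_
    (hb.swap_diag (a := 5) (c := 9) (by decide) (by decide) rfl h4)
  simp [swapMap_basisCovector, Equiv.swap_apply_def]
  module

theorem difference_diag (hb : IsRootInvariant b) :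
    b (basisCovector 6 - basisCovector 7) (basisCovector 6 - basisCovector 7) = 0 := by
  refine hb.reflect_diag ?_ hb.triple_diag
  simp [reflect_exceptional_basisCovector]
  module

theorem difference_diag' (hb : IsRootInvariant b) {a c : Fin 10} (ha : 2 ≤ a) (hc : 2 ≤ c)
    (hac : a ≠ c) : b (basisCovector a - basisCovector c) (basisCovector a - basisCovector c) = 0 := by
  have h7 : 2 ≤ Equiv.swap 6 a 7 ∧ Equiv.swap 6 a 7 ≠ a := by
    have : ∀ a : Fin 10, 2 ≤ a → 2 ≤ Equiv.swap 6 a 7 ∧ Equiv.swap 6 a 7 ≠ a := by decide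
    exact this a ha
  -- After 6 is moved to a, the second index sits at 7, or at 6 if a = 7; the swap expression covers
  -- both cases.
  refine hb.swap_diag (a := Equiv.swap 6 a 7) (c := c) h7.1 hc ?_
    (hb.swap_diag (a := 6) (c := a) (by decide) ha rfl hb.difference_diag)
  simp only [map_sub, swapMap_basisCovector, Equiv.swap_apply_left]
  rw [Equiv.swap_apply_of_ne_of_ne h7.2.symm hac]

/-- The square of the sum plus the squares of the three differences is three times the sum of the
squares. -/
theorem add_squares {x y z : Covector} (h : b (x + y + z) (x + y + z) = 0)
    (hxy : b (x - y) (x - y) = 0) (hxz : b (x - z) (x - z) = 0) (hyz : b (y - z) (y - z) = 0) :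
    b x x + b y y + b z z = 0 := by
  simp only [map_add, map_sub, LinearMap.add_apply, LinearMap.sub_apply] at h hxy hxz hyz
  linear_combination (norm := module) (1 / 3 : ℝ) • (h + hxy + hxz + hyz)

theorem basis_nine_nine (hb : IsRootInvariant b) : b (basisCovector 9) (basisCovector 9) = 0 := by
  have hd : ∀ {a c : Fin 10}, 2 ≤ a → 2 ≤ c → a ≠ c →
    b (basisCovector a - basisCovector c) (basisCovector a - basisCovector c) = 0 :=
    hb.difference_diag'
  have h689 := add_squares hb.triple_diag (hd (by decide) (by decide) (by decide))
    (hd (by decide) (by decide) (by decide)) (hd (by decide) (by decide) (by decide))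
  have h687 := add_squares (x := basisCovector 6) (y := basisCovector 8) (z := basisCovector 7)
    (hb.swap_diag (a := 7) (c := 9) (by decide) (by decide)
      (by simp [swapMap_basisCovector, Equiv.swap_apply_def]) hb.triple_diag)
    (hd (by decide) (by decide) (by decide)) (hd (by decide) (by decide) (by decide))
    (hd (by decide) (by decide) (by decide))
  have h679 := add_squares (x := basisCovector 6) (y := basisCovector 7) (z := basisCovector 9)
    (hb.swap_diag (a := 7) (c := 8) (by decide) (by decide)
      (by simp [swapMap_basisCovector, Equiv.swap_apply_def]) hb.triple_diag)
    (hd (by decide) (by decide) (by decide)) (hd (by decide) (by decide) (by decide))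
    (hd (by decide) (by decide) (by decide))
  have h789 := add_squares (x := basisCovector 7) (y := basisCovector 8) (z := basisCovector 9)
    (hb.swap_diag (a := 6) (c := 7) (by decide) (by decide)
      (by simp [swapMap_basisCovector, Equiv.swap_apply_def]) hb.triple_diag)
    (hd (by decide) (by decide) (by decide)) (hd (by decide) (by decide) (by decide))
    (hd (by decide) (by decide) (by decide))
  -- The three sums containing index 9 count it three times and each of 6, 7, 8 twice.
  linear_combination (norm := module) (1 / 3 : ℝ) • (h689 + h679 + h789) - (2 / 3 : ℝ) • h687

theorem basis_diag (hb : IsRootInvariant b) {a : Fin 10} (ha : 2 ≤ a) :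
    b (basisCovector a) (basisCovector a) = 0 :=
  hb.swap_diag (a := 9) (c := a) (by decide) ha
    (by rw [swapMap_basisCovector, Equiv.swap_apply_left]) hb.basis_nine_nine

theorem basis_basis (hb : IsRootInvariant b) {a c : Fin 10} (ha : 2 ≤ a) (hc : 2 ≤ c) :
    b (basisCovector a) (basisCovector c) = 0 := by
  rcases eq_or_ne a c with rfl | hac
  · exact hb.basis_diag ha
  · have h1 := hb.difference_diag' ha hc hac
    simp only [map_sub, LinearMap.sub_apply, hb.basis_diag ha, hb.basis_diag hc,
      hb.symm (basisCovector c)] at h1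
    linear_combination (norm := module) (-1 / 2 : ℝ) • h1

/-- δ is the sum of e^1 to e^9 and pairs to zero with e^a; all summands but the one from e^1 are
already known to vanish. -/
theorem one_basis (hb : IsRootInvariant b) {a : Fin 10} (ha : 1 ≤ a) :
    b (basisCovector 1) (basisCovector a) = 0 := by
  have h1 : ∀ c : Fin 10, 2 ≤ c → b (basisCovector c) (basisCovector a) = 0 := fun c hc => by
    rcases eq_or_ne a 1 with rfl | ha'
    · have h2 := hb.null_basis hc
      rw [hb.symm, nullRoot_eq] at h2
      simp only [map_add, hb.basis_basis hc (c := 2) (by decide),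
        hb.basis_basis hc (c := 3) (by decide), hb.basis_basis hc (c := 4) (by decide),
        hb.basis_basis hc (c := 5) (by decide), hb.basis_basis hc (c := 6) (by decide),
        hb.basis_basis hc (c := 7) (by decide), hb.basis_basis hc (c := 8) (by decide),
        hb.basis_basis hc (c := 9) (by decide), add_zero] at h2
      exact h2
    · exact hb.basis_basis hc (by omega)
  have h2 := hb.null_eq_zero (basisCovector a) (by
    rw [basisCovector, Pi.single_eq_of_ne (by omega)])
  rw [nullRoot_eq] at h2
  simp only [map_add, LinearMap.add_apply, h1 2 (by decide), h1 3 (by decide), h1 4 (by decide),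
    h1 5 (by decide), h1 6 (by decide), h1 7 (by decide), h1 8 (by decide), h1 9 (by decide),
    add_zero] at h2
  exact h2

theorem zero_basis (hb : IsRootInvariant b) {a : Fin 10} (ha : a ≠ 1) :
    b (basisCovector 0) (basisCovector a) = 0 := by
  have h1 := hb.reflect_simple 0 (by decide) _ _
    -- The conditional is the preimage of a under the exchange of 0 and 1, the reflection in α_0.
    -- For a = 1 it would be 0, which is not yet covered.
    (hb.one_basis (a := if a = 0 then 1 else a) (by split_ifs <;> omega))
  rw [reflect_line_basisCovector _ _ (by decide), reflect_line_basisCovector _ _ (by decide)] at h1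
  have h2 : ∀ a : Fin 10, a ≠ 1 → Equiv.swap (0 : Fin 10) (0 + 1) (if a = 0 then 1 else a) = a := by
    decide
  rwa [h2 a ha, show Equiv.swap (0 : Fin 10) (0 + 1) 1 = 0 by decide] at h1

/-- With γ = δ + α_1, the reflection in γ sends e^0 to e^0 + γ. Since e^0 and γ are isotropic this
leaves 2b(e^0, γ) = 0, and γ contains e^1 with coefficient 2 while its other terms pair to zero with
e^0. -/
theorem zero_one (hb : IsRootInvariant b) : b (basisCovector 0) (basisCovector 1) = 0 := by
  have hγ : nullRoot + simpleRoot 1 = (2 : ℝ) • basisCovector 1 + basisCovector 3 +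
      basisCovector 4 + basisCovector 5 + basisCovector 6 + basisCovector 7 + basisCovector 8 +
      basisCovector 9 := by
    rw [nullRoot_eq, simpleRoot_one_eq]
    module
  have hr : reflect (nullRoot + simpleRoot 1) (basisCovector 0) =
      basisCovector 0 + (nullRoot + simpleRoot 1) := by
    have hf : form (nullRoot + simpleRoot 1) (basisCovector 0) = -1 := by
      rw [form_basisCovector, hγ]
      simp only [Pi.add_apply, Pi.smul_apply, Finset.sum_add_distrib, ← Finset.smul_sum,
        sum_basisCovector]
      simp [basisCovector]
      norm_num
    rw [reflect_apply, hf]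
    module
  have h0 := hb.zero_basis (a := 0) (by decide)
  have h1 := hb.reflect_root _ _ h0
  have h2 : b (nullRoot + simpleRoot 1) (nullRoot + simpleRoot 1) = 0 := by
    have h3 := hb.null_eq_zero nullRoot (by simp [nullRoot_eq, basisCovector])
    have h4 := hb.null_eq_zero (simpleRoot 1) (by simp [simpleRoot_one_eq, basisCovector])
    rw [map_add, map_add, LinearMap.add_apply, LinearMap.add_apply, h3, h4,
      hb.symm (simpleRoot 1) nullRoot, h4, hb.root_one]
    simp
  rw [hr, map_add b, LinearMap.add_apply, map_add, map_add (b (nullRoot + simpleRoot 1)), h0, h2,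
    hb.symm (nullRoot + simpleRoot 1), hγ] at h1
  simp only [map_add, map_smul, hb.zero_basis (a := 3) (by decide),
    hb.zero_basis (a := 4) (by decide), hb.zero_basis (a := 5) (by decide),
    hb.zero_basis (a := 6) (by decide), hb.zero_basis (a := 7) (by decide),
    hb.zero_basis (a := 8) (by decide), hb.zero_basis (a := 9) (by decide)] at h1
  linear_combination (norm := module) (1 / 4 : ℝ) • h1

/-- A symmetric bilinear map satisfying the invariance hypotheses vanishes. -/
theorem eq_zero (hb : IsRootInvariant b) : b = 0 := by
  refine LinearMap.pi_ext' fun a => LinearMap.ext_ring ?_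
  refine LinearMap.pi_ext' fun c => LinearMap.ext_ring ?_
  change b (basisCovector a) (basisCovector c) = 0
  have h0 : ∀ c, b (basisCovector 0) (basisCovector c) = 0 := fun c => by
    rcases eq_or_ne c 1 with rfl | hc
    · exact hb.zero_one
    · exact hb.zero_basis hc
  rcases eq_or_ne a 0 with rfl | ha
  · exact h0 c
  rcases eq_or_ne c 0 with rfl | hc
  · rw [hb.symm]
    exact h0 a
  rcases eq_or_ne a 1 with rfl | ha'
  · exact hb.one_basis (by omega)
  rcases eq_or_ne c 1 with rfl | hc'
  · rw [hb.symm]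
    exact hb.one_basis (by omega)
  exact hb.basis_basis (by omega) (by omega)

end IsRootInvariant

end Invariant

end

end E10

namespace E10

noncomputable section

open scoped Kronecker

/-! ### Elements of `K(E₁₀)` attached to real roots -/

/-- The sum of the simple roots in a list. -/
def rootSum (l : List (Fin 10)) : Covector := (l.map simpleRoot).sum

/-- The product of the `Γ(α_i)` along a list. -/
def gammaProd (Γ : Fin 10 → Matrix (Fin 32) (Fin 32) ℝ) (l : List (Fin 10)) :
    Matrix (Fin 32) (Fin 32) ℝ := (l.map (gammaRoot Γ)).prod

/-- The pairing of two sums of simple roots. -/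
def pairing (l m : List (Fin 10)) : ℤ := (l.map fun i => (m.map (cartan i)).sum).sum

theorem rootSum_append (l m : List (Fin 10)) : rootSum (l ++ m) = rootSum l + rootSum m := by
  simp [rootSum]

theorem gammaProd_append (Γ : Fin 10 → Matrix (Fin 32) (Fin 32) ℝ) (l m : List (Fin 10)) :
    gammaProd Γ (l ++ m) = gammaProd Γ l * gammaProd Γ m := by
  simp [gammaProd]

theorem rootSum_singleton (i : Fin 10) : rootSum [i] = simpleRoot i := by simp [rootSum]

theorem gammaProd_singleton (Γ : Fin 10 → Matrix (Fin 32) (Fin 32) ℝ) (i : Fin 10) :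
    gammaProd Γ [i] = gammaRoot Γ i := by simp [gammaProd]

theorem form_rootSum (l m : List (Fin 10)) : form (rootSum l) (rootSum m) = pairing l m := by
  induction l with
  | nil => simp [rootSum, pairing]
  | cons i l ih =>
    have h1 : form (simpleRoot i) (rootSum m) = (m.map (cartan i)).sum := by
      clear ih
      induction m with
      | nil => simp [rootSum]
      | cons j m ih => simpa [rootSum, form_simpleRoot] using ih
    simp only [rootSum, pairing, List.map_cons, List.sum_cons, map_add, LinearMap.add_apply,
      Int.cast_add] at ih h1 ⊢
    rw [ih, h1]

variable {Γ : Fin 10 → Matrix (Fin 32) (Fin 32) ℝ}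

theorem gammaProd_mul (hΓ : IsGammaSystem Γ) (l m : List (Fin 10)) :
    gammaProd Γ l * gammaProd Γ m =
      (pairing l m).negOnePow • (gammaProd Γ m * gammaProd Γ l) :=
  List.prod_mul_prod_comm_sign _ _ (gammaRoot_mul hΓ) l m

theorem gammaProd_anti (hΓ : IsGammaSystem Γ) {l m : List (Fin 10)} (h : Odd (pairing l m)) :
    gammaProd Γ l * gammaProd Γ m = -(gammaProd Γ m * gammaProd Γ l) := by
  rw [gammaProd_mul hΓ, Int.negOnePow_odd _ h, Units.neg_smul, one_smul]

theorem gammaProd_comm (hΓ : IsGammaSystem Γ) {l m : List (Fin 10)} (h : Even (pairing l m)) :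
    gammaProd Γ l * gammaProd Γ m = gammaProd Γ m * gammaProd Γ l := by
  rw [gammaProd_mul hΓ, Int.negOnePow_even _ h, one_smul]

variable {ρ₁ : K →ₗ⁅ℝ⁆ Matrix (Fin 32) (Fin 32) ℝ}
  {ρ₃ : K →ₗ⁅ℝ⁆ Matrix (Fin 10 × Fin 32) (Fin 10 × Fin 32) ℝ}

variable (Γ ρ₁ ρ₃) in
/-- The real root which is the sum of the simple roots in `l` is represented by an element of
`K(E₁₀)` with the expected images under both representations. -/
structure IsRealised (l : List (Fin 10)) : Prop where
  norm : form (rootSum l) (rootSum l) = 2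
  sq : gammaProd Γ l * gammaProd Γ l = -1
  -- Each bracket brings a relative sign between the two images, from `polar_anti`; double brackets
  -- with y do not see σ.
  exists_element : ∃ y : K, ∃ σ : ℤˣ, ρ₁ y = (1 / 2 : ℝ) • gammaProd Γ l ∧
    ρ₃ y = σ • (polar (rootSum l) ⊗ₖ gammaProd Γ l)

theorem isRealised_singleton (hΓ : IsGammaSystem Γ) (h₁ : IsSpinHalf Γ ρ₁)
    (h₃ : IsSpinThreeHalves Γ ρ₃) (i : Fin 10) : IsRealised Γ ρ₁ ρ₃ [i] where
  norm := by simpa [rootSum] using form_simpleRoot_self i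
  sq := by simpa [gammaProd] using gammaRoot_sq hΓ i
  exists_element := ⟨KacMoody.x cartan i, 1, by simpa [gammaProd] using h₁ i,
    by simpa [gammaProd, rootSum] using isSpinThreeHalves_iff.1 h₃ i⟩

theorem neg_kronecker {m n : Type} (M : Matrix m m ℝ) (N : Matrix n n ℝ) :
    (-M) ⊗ₖ N = -(M ⊗ₖ N) := by
  rw [← neg_one_smul ℝ M, Matrix.smul_kronecker, neg_one_smul]

theorem lie_smul_smul_self_units {R : Type} [Ring R] (σ τ : ℤˣ) (a c : R) :
    ⁅σ • a, τ • c⁆ = (σ * τ) • ⁅a, c⁆ := by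
  rcases Int.units_eq_one_or σ with rfl | rfl <;> rcases Int.units_eq_one_or τ with rfl | rfl <;>
    simp [Ring.lie_def, Units.neg_smul, neg_add_eq_sub]

theorem IsRealised.append (hΓ : IsGammaSystem Γ) {l m : List (Fin 10)}
    (hl : IsRealised Γ ρ₁ ρ₃ l) (hm : IsRealised Γ ρ₁ ρ₃ m) (hlm : pairing l m = -1) :
    IsRealised Γ ρ₁ ρ₃ (l ++ m) := by
  have hf : form (rootSum l) (rootSum m) = -1 := by
    rw [form_rootSum, hlm]
    norm_num
  have hanti : gammaProd Γ m * gammaProd Γ l = -(gammaProd Γ l * gammaProd Γ m) := by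
    rw [gammaProd_anti hΓ (l := l) (by rw [hlm]; decide), neg_neg]
  obtain ⟨y, σ, hy₁, hy₃⟩ := hl.exists_element
  obtain ⟨z, τ, hz₁, hz₃⟩ := hm.exists_element
  refine ⟨?_, ?_, ⁅y, z⁆, -(σ * τ), ?_, ?_⟩
  · rw [rootSum_append, map_add, map_add, LinearMap.add_apply, LinearMap.add_apply, hl.norm,
      hm.norm, form_comm (rootSum m), hf]
    norm_num
  · rw [gammaProd_append]
    calc gammaProd Γ l * gammaProd Γ m * (gammaProd Γ l * gammaProd Γ m)
        = gammaProd Γ l * (gammaProd Γ m * gammaProd Γ l) * gammaProd Γ m := by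
          simp only [mul_assoc]
      _ = -(gammaProd Γ l * gammaProd Γ l * (gammaProd Γ m * gammaProd Γ m)) := by
          rw [hanti]
          simp only [mul_assoc, mul_neg, neg_mul]
      _ = -1 := by rw [hl.sq, hm.sq]; simp
  · rw [LieHom.map_lie, hy₁, hz₁, Ring.lie_def, gammaProd_append]
    simp only [mul_smul_comm, smul_mul_assoc, hanti]
    module
  · rw [LieHom.map_lie, hy₃, hz₃, lie_smul_smul_self_units, lie_kronecker_of_anti hanti,
      polar_anti hf, rootSum_append, gammaProd_append, neg_kronecker, Units.neg_smul, smul_neg]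

/-- A list each entry of which pairs to `-1` with the sum of its tail. -/
def IsChain : List (Fin 10) → Prop
  | [] => False
  | [_] => True
  | i :: j :: l => pairing [i] (j :: l) = -1 ∧ IsChain (j :: l)

instance : DecidablePred IsChain := fun l => by
  induction l with
  | nil => exact instDecidableFalse
  | cons i l ih =>
    cases l with
    | nil => exact instDecidableTrue
    | cons j l => exact instDecidableAnd

theorem IsChain.isRealised (hΓ : IsGammaSystem Γ) (h₁ : IsSpinHalf Γ ρ₁)
    (h₃ : IsSpinThreeHalves Γ ρ₃) : ∀ l, IsChain l → IsRealised Γ ρ₁ ρ₃ l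
  | [], h => h.elim
  | [i], _ => isRealised_singleton hΓ h₁ h₃ i
  | i :: j :: l, h =>
    (isRealised_singleton hΓ h₁ h₃ i).append hΓ (IsChain.isRealised hΓ h₁ h₃ (j :: l) h.2) h.1

/-- Simple roots with sum `δ - α_2`. -/
def nullChain : List (Fin 10) :=
  [1, 3, 4, 5, 6, 7, 8, 9, 6, 5, 4, 3, 2, 7, 6, 5, 4, 3, 9, 6, 5, 4, 7, 6, 5, 8, 7, 6, 9]

/-- Simple roots with sum `δ + α_1`. -/
def rootChain : List (Fin 10) := [1, 2] ++ nullChain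

/-- Simple roots with sum `2δ + α_1`. -/
def doubleChain : List (Fin 10) := ([2] ++ rootChain) ++ nullChain

theorem isRealised_nullChain (hΓ : IsGammaSystem Γ) (h₁ : IsSpinHalf Γ ρ₁)
    (h₃ : IsSpinThreeHalves Γ ρ₃) : IsRealised Γ ρ₁ ρ₃ nullChain :=
  IsChain.isRealised hΓ h₁ h₃ _ (by decide)

/-- δ is not a real root, so a shift by δ is made in two steps, adding α_2 and then δ - α_2. Both
pairings are -1, here and in the shift to 2δ + α_1. -/
theorem isRealised_rootChain (hΓ : IsGammaSystem Γ) (h₁ : IsSpinHalf Γ ρ₁)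
    (h₃ : IsSpinThreeHalves Γ ρ₃) : IsRealised Γ ρ₁ ρ₃ rootChain :=
  (IsChain.isRealised hΓ h₁ h₃ [1, 2] (by decide)).append hΓ (isRealised_nullChain hΓ h₁ h₃)
    (by decide)

theorem isRealised_doubleChain (hΓ : IsGammaSystem Γ) (h₁ : IsSpinHalf Γ ρ₁)
    (h₃ : IsSpinThreeHalves Γ ρ₃) : IsRealised Γ ρ₁ ρ₃ doubleChain :=
  ((isRealised_singleton hΓ h₁ h₃ 2).append hΓ (isRealised_rootChain hΓ h₁ h₃)
    (by decide)).append hΓ (isRealised_nullChain hΓ h₁ h₃) (by decide)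

theorem rootSum_eq_intCast (l : List (Fin 10)) (a : Fin 10) :
    rootSum l a = ((l.map fun i => simpleRootInt i a).sum : ℤ) := by
  induction l with
  | nil => simp [rootSum]
  | cons i l ih =>
    simp only [rootSum, List.map_cons, List.sum_cons, Pi.add_apply, Int.cast_add] at ih ⊢
    rw [ih, simpleRoot_eq_intCast]

theorem nullRoot_apply (a : Fin 10) : nullRoot a = ((if a = 0 then 0 else 1 : ℤ) : ℝ) := by
  fin_cases a <;> simp [IsRootInvariant.nullRoot_eq, basisCovector]

theorem rootSum_rootChain : rootSum rootChain = nullRoot + simpleRoot 1 := by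
  ext a
  have h1 : ∀ a, (rootChain.map fun i => simpleRootInt i a).sum =
    (if a = 0 then 0 else 1) + simpleRootInt 1 a := by decide
  rw [rootSum_eq_intCast, h1, Pi.add_apply, nullRoot_apply, simpleRoot_eq_intCast, Int.cast_add]

theorem rootSum_doubleChain : rootSum doubleChain = (2 : ℝ) • nullRoot + simpleRoot 1 := by
  ext a
  have h1 : ∀ a, (doubleChain.map fun i => simpleRootInt i a).sum =
    2 * (if a = 0 then 0 else 1) + simpleRootInt 1 a := by decide
  rw [rootSum_eq_intCast, h1, Pi.add_apply, Pi.smul_apply, nullRoot_apply, simpleRoot_eq_intCast,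
    Int.cast_add, Int.cast_mul]
  simp

/-! ### The kernels of the two representations -/

variable (Γ ρ₁ ρ₃) in
/-- The matrices `M` such that `M ⊗ Γ(α_0)` is the image of an element of the kernel of the
spin-1/2 representation. -/
def kernelImage : Submodule ℝ (Matrix (Fin 10) (Fin 10) ℝ) where
  carrier := {M | ∃ w : K, ρ₁ w = 0 ∧ ρ₃ w = M ⊗ₖ gammaProd Γ [0]}
  add_mem' := by
    rintro M N ⟨w, hw₁, hw₃⟩ ⟨v, hv₁, hv₃⟩
    exact ⟨w + v, by rw [map_add, hw₁, hv₁, add_zero],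
      by rw [map_add, hw₃, hv₃, Matrix.add_kronecker]⟩
  zero_mem' := ⟨0, map_zero _, by rw [map_zero, Matrix.zero_kronecker]⟩
  smul_mem' := by
    rintro c M ⟨w, hw₁, hw₃⟩
    exact ⟨c • w, by rw [map_smul, hw₁, smul_zero], by rw [map_smul, hw₃, Matrix.smul_kronecker]⟩

theorem lie_lie_units_smul {R : Type} [Ring R] (σ : ℤˣ) (a c : R) :
    ⁅σ • a, ⁅σ • a, c⁆⁆ = ⁅a, ⁅a, c⁆⁆ := by
  rcases Int.units_eq_one_or σ with rfl | rfl
  · simp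
  · simp only [Ring.lie_def, Units.neg_smul, one_smul]
    noncomm_ring

/-- The spin-½ kernel is an ideal, and the double bracket acts on M as -(2LR + 1), with L and R the
multiplications by the dyad; adding M isolates LR. -/
theorem IsRealised.dyad_mul_mem (hΓ : IsGammaSystem Γ) {l : List (Fin 10)}
    (hl : IsRealised Γ ρ₁ ρ₃ l) (hodd : Odd (pairing [0] l)) {M : Matrix (Fin 10) (Fin 10) ℝ}
    (hM : M ∈ kernelImage Γ ρ₁ ρ₃) :
    dyad (rootSum l) (rootSum l) * M * dyad (rootSum l) (rootSum l) ∈ kernelImage Γ ρ₁ ρ₃ := by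
  obtain ⟨y, σ, -, hy₃⟩ := hl.exists_element
  obtain ⟨w, hw₁, hw₃⟩ := id hM
  have h1 : -((2 : ℝ) • (dyad (rootSum l) (rootSum l) * M * dyad (rootSum l) (rootSum l)) + M) ∈
      kernelImage Γ ρ₁ ρ₃ := by
    refine ⟨⁅y, ⁅y, w⁆⁆, ?_, ?_⟩
    · rw [LieHom.map_lie, LieHom.map_lie, hw₁, lie_zero, lie_zero]
    · rw [LieHom.map_lie, LieHom.map_lie, hy₃, hw₃, lie_lie_units_smul,
        lie_lie_kronecker_of_anti hl.sq (gammaProd_anti hΓ hodd), polar_anti_anti hl.norm,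
        neg_kronecker]
  have h2 := Submodule.smul_mem _ (-1 / 2 : ℝ) (add_mem h1 hM)
  convert h2 using 1
  module

/-- For commuting gamma factors the double bracket acts as -2(1 - (1 - L)(1 - R)), from which the
two-sided reflection is recovered. -/
theorem IsRealised.reflect_mem (hΓ : IsGammaSystem Γ) {l : List (Fin 10)}
    (hl : IsRealised Γ ρ₁ ρ₃ l) (heven : Even (pairing [0] l)) {M : Matrix (Fin 10) (Fin 10) ℝ}
    (hM : M ∈ kernelImage Γ ρ₁ ρ₃) :
    (1 - dyad (rootSum l) (rootSum l)) * M * (1 - dyad (rootSum l) (rootSum l)) ∈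
      kernelImage Γ ρ₁ ρ₃ := by
  obtain ⟨y, σ, -, hy₃⟩ := hl.exists_element
  obtain ⟨w, hw₁, hw₃⟩ := id hM
  have h1 : -((2 : ℝ) • (M - (1 - dyad (rootSum l) (rootSum l)) * M *
      (1 - dyad (rootSum l) (rootSum l)))) ∈ kernelImage Γ ρ₁ ρ₃ := by
    refine ⟨⁅y, ⁅y, w⁆⁆, ?_, ?_⟩
    · rw [LieHom.map_lie, LieHom.map_lie, hw₁, lie_zero, lie_zero]
    · rw [LieHom.map_lie, LieHom.map_lie, hy₃, hw₃, lie_lie_units_smul,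
        lie_lie_kronecker_of_comm hl.sq (gammaProd_comm hΓ heven), polar_comm_comm hl.norm,
        neg_kronecker]
  have h2 := add_mem (Submodule.smul_mem _ (1 / 2 : ℝ) h1) hM
  convert h2 using 1
  module

/-- The element [y,[y,x_0]] + x_0 vanishes in spin ½ for every odd pairing, but in spin 3/2 only
when the pairing has square 1. -/
theorem IsRealised.dyad_mem (hΓ : IsGammaSystem Γ) (h₁ : IsSpinHalf Γ ρ₁)
    (h₃ : IsSpinThreeHalves Γ ρ₃) {l : List (Fin 10)} (hl : IsRealised Γ ρ₁ ρ₃ l)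
    (hodd : Odd (pairing [0] l)) (hne : pairing l [0] ^ 2 ≠ 1) :
    dyad (rootSum l) (rootSum l) ∈ kernelImage Γ ρ₁ ρ₃ := by
  obtain ⟨y, σ, hy₁, hy₃⟩ := hl.exists_element
  have hanti := gammaProd_anti hΓ hodd
  have hz₁ : ρ₁ (KacMoody.x cartan 0) = (1 / 2 : ℝ) • gammaProd Γ [0] := by
    rw [gammaProd_singleton]
    exact h₁ 0
  have hz₃ : ρ₃ (KacMoody.x cartan 0) = polar (rootSum [0]) ⊗ₖ gammaProd Γ [0] := by
    rw [gammaProd_singleton, rootSum_singleton]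
    exact isSpinThreeHalves_iff.1 h₃ 0
  have h1 : (-2 * ((pairing l [0] : ℝ) ^ 2 - 1)) • dyad (rootSum l) (rootSum l) ∈
      kernelImage Γ ρ₁ ρ₃ := by
    refine ⟨⁅y, ⁅y, KacMoody.x cartan 0⁆⁆ + KacMoody.x cartan 0, ?_, ?_⟩
    · rw [map_add, LieHom.map_lie, LieHom.map_lie, hy₁, hz₁, lie_lie_of_anti hl.sq hanti,
        neg_add_cancel]
    · rw [map_add, LieHom.map_lie, LieHom.map_lie, hy₃, hz₃, lie_lie_units_smul,
        lie_lie_kronecker_of_anti hl.sq hanti, polar_anti_anti hl.norm,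
        dyad_mul_polar_mul_dyad hl.norm, form_rootSum, Matrix.add_kronecker, neg_add,
        neg_add_cancel_right, smul_smul, neg_mul, neg_smul, neg_kronecker]
  have h2 : -2 * ((pairing l [0] : ℝ) ^ 2 - 1) ≠ 0 :=
    mul_ne_zero (by norm_num) (sub_ne_zero.2 (by exact_mod_cast hne))
  exact (Submodule.smul_mem_iff _ h2).1 h1

theorem dyad_mul_dyad_mul_dyad (x y z : Covector) :
    dyad z z * dyad x y * dyad z z = (form z x * form y z) • dyad z z := by
  rw [dyad_mul_dyad, smul_mul_assoc, dyad_mul_dyad, smul_smul]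

theorem one_sub_dyad_mul (x y z : Covector) :
    (1 - dyad z z) * dyad x y * (1 - dyad z z) = dyad (reflect z x) (reflect z y) := by
  simp only [reflect_apply, mul_sub, sub_mul, one_mul, mul_one, dyad_mul_dyad, smul_mul_assoc,
    map_sub, map_smul, LinearMap.sub_apply, LinearMap.smul_apply, form_comm y z]
  module

variable (Γ ρ₁ ρ₃) in
/-- The symmetrised dyads modulo `kernelImage`. -/
def symmetricDyad :
    Covector →ₗ[ℝ] Covector →ₗ[ℝ] Matrix (Fin 10) (Fin 10) ℝ ⧸ kernelImage Γ ρ₁ ρ₃ :=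
  (dyad + dyad.flip).compr₂ (kernelImage Γ ρ₁ ρ₃).mkQ

theorem symmetricDyad_eq_zero_iff {x y : Covector} :
    symmetricDyad Γ ρ₁ ρ₃ x y = 0 ↔ dyad x y + dyad y x ∈ kernelImage Γ ρ₁ ρ₃ := by
  rw [← Submodule.Quotient.mk_eq_zero]
  rfl

theorem symmetricDyad_self_eq_zero {x : Covector} (hx : dyad x x ∈ kernelImage Γ ρ₁ ρ₃) :
    symmetricDyad Γ ρ₁ ρ₃ x x = 0 :=
  symmetricDyad_eq_zero_iff.2 (add_mem hx hx)

theorem IsRealised.symmetricDyad_reflect (hΓ : IsGammaSystem Γ) {l : List (Fin 10)}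
    (hl : IsRealised Γ ρ₁ ρ₃ l) (heven : Even (pairing [0] l)) {x y : Covector}
    (h : symmetricDyad Γ ρ₁ ρ₃ x y = 0) :
    symmetricDyad Γ ρ₁ ρ₃ (reflect (rootSum l) x) (reflect (rootSum l) y) = 0 := by
  rw [symmetricDyad_eq_zero_iff] at h ⊢
  have h1 := hl.reflect_mem hΓ heven h
  rwa [mul_add, add_mul, one_sub_dyad_mul, one_sub_dyad_mul] at h1

theorem dyad_doubleRoot_mem (hΓ : IsGammaSystem Γ) (h₁ : IsSpinHalf Γ ρ₁)
    (h₃ : IsSpinThreeHalves Γ ρ₃) :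
    dyad (rootSum doubleChain) (rootSum doubleChain) ∈ kernelImage Γ ρ₁ ρ₃ :=
  (isRealised_doubleChain hΓ h₁ h₃).dyad_mem hΓ h₁ h₃ (by decide) (by decide)

theorem isRootInvariant_symmetricDyad (hΓ : IsGammaSystem Γ) (h₁ : IsSpinHalf Γ ρ₁)
    (h₃ : IsSpinThreeHalves Γ ρ₃) : IsRootInvariant (symmetricDyad Γ ρ₁ ρ₃) where
  symm x y := by
    change (kernelImage Γ ρ₁ ρ₃).mkQ (dyad x y + dyad y x) =
      (kernelImage Γ ρ₁ ρ₃).mkQ (dyad y x + dyad x y)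
    rw [add_comm]
  reflect_simple i hi x y h := by
    have heven : ∀ i : Fin 10, i ≠ 1 → Even (pairing [0] [i]) := by decide
    rw [← rootSum_singleton i]
    exact (isRealised_singleton hΓ h₁ h₃ i).symmetricDyad_reflect hΓ (heven i hi) h
  reflect_root x y h := by
    rw [← rootSum_rootChain]
    exact (isRealised_rootChain hΓ h₁ h₃).symmetricDyad_reflect hΓ (by decide) h
  root_one := by
    -- α_1 pairs oddly with α_0 and nontrivially with 2δ + α_1, so sandwiching the known dyad gives
    -- a nonzero multiple of the dyad of α_1.
    have h1 := (isRealised_singleton hΓ h₁ h₃ 1).dyad_mul_mem hΓ (by decide)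
      (dyad_doubleRoot_mem hΓ h₁ h₃)
    have hne : ((pairing [1] doubleChain : ℤ) : ℝ) * (pairing doubleChain [1] : ℤ) ≠ 0 := by
      have h2 : pairing [1] doubleChain * pairing doubleChain [1] ≠ 0 := by decide
      exact_mod_cast h2
    rw [dyad_mul_dyad_mul_dyad, form_rootSum, form_rootSum, Submodule.smul_mem_iff _ hne,
      rootSum_singleton] at h1
    exact symmetricDyad_self_eq_zero h1
  root_two := by
    rw [← rootSum_doubleChain]
    exact symmetricDyad_self_eq_zero (dyad_doubleRoot_mem hΓ h₁ h₃)

theorem dyad_self_mem (hΓ : IsGammaSystem Γ) (h₁ : IsSpinHalf Γ ρ₁)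
    (h₃ : IsSpinThreeHalves Γ ρ₃) (x : Covector) : dyad x x ∈ kernelImage Γ ρ₁ ρ₃ := by
  have h1 : symmetricDyad Γ ρ₁ ρ₃ x x = 0 := by
    rw [(isRootInvariant_symmetricDyad hΓ h₁ h₃).eq_zero]
    rfl
  rw [symmetricDyad_eq_zero_iff, ← two_smul ℝ] at h1
  exact (Submodule.smul_mem_iff _ two_ne_zero).1 h1

/-- The inverse of the DeWitt metric is δ_ab - 1; raising one of its indices gives the identity. -/
theorem one_eq_sum_dyad :
    (1 : Matrix (Fin 10) (Fin 10) ℝ) = ∑ c, dyad (Pi.single c 1) (Pi.single c 1) - dyad 1 1 := by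
  ext i j
  have h1 : ∀ c, dyad (Pi.single c 1) (Pi.single c 1) i j = if j = c then deWitt i c else 0 :=
    fun c => by
      simp [dyad_apply, Matrix.vecMulVec_apply, Pi.single_apply]
  have h2 : dyad 1 1 i j = ∑ c, deWitt i c := by
    simp [dyad_apply, Matrix.vecMulVec_apply, Matrix.mulVec, dotProduct]
  rw [Matrix.sub_apply, Matrix.sum_apply, h2]
  simp only [h1, Finset.sum_ite_eq, Finset.mem_univ, if_true, deWitt, Matrix.of_apply,
    Matrix.one_apply, Finset.sum_sub_distrib]
  simp
  norm_num

theorem polar_mem (hΓ : IsGammaSystem Γ) (h₁ : IsSpinHalf Γ ρ₁)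
    (h₃ : IsSpinThreeHalves Γ ρ₃) (x : Covector) : polar x ∈ kernelImage Γ ρ₁ ρ₃ := by
  have h := dyad_self_mem hΓ h₁ h₃
  rw [polar, one_eq_sum_dyad]
  exact sub_mem (h x) (Submodule.smul_mem _ _ (sub_mem (sum_mem fun c _ => h _) (h 1)))

/-! ### The two non-inclusions. -/

theorem not_ker_threeHalves_le_ker_half (hΓ : IsGammaSystem Γ) (h₁ : IsSpinHalf Γ ρ₁)
    (h₃ : IsSpinThreeHalves Γ ρ₃) : ¬ ρ₃.ker ≤ ρ₁.ker := by
  intro hle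
  obtain ⟨w, hw₁, hw₃⟩ := polar_mem hΓ h₁ h₃ (simpleRoot 0)
  have h1 : KacMoody.x cartan 0 - w ∈ ρ₃.ker := by
    rw [LieHom.mem_ker, map_sub, hw₃, isSpinThreeHalves_iff.1 h₃ 0, gammaProd_singleton, sub_self]
  have h2 := hle h1
  rw [LieHom.mem_ker, map_sub, hw₁, sub_zero, h₁ 0] at h2
  exact ne_zero_of_sq (gammaRoot_sq hΓ 0) ((smul_eq_zero_iff_right (by norm_num)).1 h2)

/-- The trace of the dyad is the norm of x. -/
theorem dyad_self_ne_zero {x : Covector} (hx : form x x = 2) : dyad x x ≠ 0 := by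
  intro h
  have h1 := congrArg Matrix.trace h
  rw [dyad_apply, Matrix.trace_vecMulVec, dotProduct_comm, Matrix.trace_zero] at h1
  rw [form, Matrix.toBilin'_apply', h1] at hx
  norm_num at hx

theorem not_ker_half_le_ker_threeHalves (hΓ : IsGammaSystem Γ) (h₁ : IsSpinHalf Γ ρ₁)
    (h₃ : IsSpinThreeHalves Γ ρ₃) : ¬ ρ₁.ker ≤ ρ₃.ker := by
  intro hle
  obtain ⟨w, hw₁, hw₃⟩ := dyad_doubleRoot_mem hΓ h₁ h₃
  have h1 := hle ((LieHom.mem_ker).2 hw₁)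
  rw [LieHom.mem_ker, hw₃, gammaProd_singleton] at h1
  obtain ⟨i, j, hij⟩ : ∃ i j, gammaRoot Γ 0 i j ≠ 0 := by
    by_contra! hzero
    exact ne_zero_of_sq (gammaRoot_sq hΓ 0) (Matrix.ext hzero)
  refine dyad_self_ne_zero (isRealised_doubleChain hΓ h₁ h₃).norm (Matrix.ext fun a c => ?_)
  have h2 := congrFun (congrFun h1 (a, i)) (c, j)
  rw [Matrix.kronecker_apply] at h2
  exact (mul_eq_zero.1 h2).resolve_right hij

end

end E10

theorem mainTheorem6 :
    (∃ Γ : Fin 10 → Matrix (Fin 32) (Fin 32) ℝ, E10.IsGammaSystem Γ) ∧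
    ∀ Γ : Fin 10 → Matrix (Fin 32) (Fin 32) ℝ, E10.IsGammaSystem Γ →
      (∃! ρ : E10.K →ₗ⁅ℝ⁆ Matrix (Fin 32) (Fin 32) ℝ, E10.IsSpinHalf Γ ρ) ∧
      (∃! ρ : E10.K →ₗ⁅ℝ⁆ Matrix (Fin 10 × Fin 32) (Fin 10 × Fin 32) ℝ,
        E10.IsSpinThreeHalves Γ ρ) ∧
      ∀ (ρ₁ : E10.K →ₗ⁅ℝ⁆ Matrix (Fin 32) (Fin 32) ℝ)
        (ρ₃ : E10.K →ₗ⁅ℝ⁆ Matrix (Fin 10 × Fin 32) (Fin 10 × Fin 32) ℝ),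
        E10.IsSpinHalf Γ ρ₁ → E10.IsSpinThreeHalves Γ ρ₃ →
          ¬ (ρ₃.ker ≤ ρ₁.ker) ∧ ¬ (ρ₁.ker ≤ ρ₃.ker) :=
  ⟨E10.exists_isGammaSystem, fun _ hΓ =>
    ⟨E10.existsUnique_spinHalf hΓ, E10.existsUnique_spinThreeHalves hΓ, fun _ _ h₁ h₃ =>
      ⟨E10.not_ker_threeHalves_le_ker_half hΓ h₁ h₃,
        E10.not_ker_half_le_ker_threeHalves hΓ h₁ h₃⟩⟩⟩
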